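/- Let $\mathfrak F$ be $\mathbb R$, $\mathbb C$ or the quaternions $\mathbb H$, with conjugation and norm as usual, and let $\beta=\dim_{\mathbb R}\mathfrak F\in\{1,2,4\}$. For a matrix $A$ over $\mathfrak F$ let $A^*$ be its conjugate transpose and $\operatorname{etr}(A)=\exp(\operatorname{Re}\operatorname{tr}A)$. Let $\mathfrak P_n^\beta$ be the cone of positive definite Hermitian $n\times n$ matrices over $\mathfrak F$, and for $A\in\mathfrak P_n^\beta$ let $|A|>0$ be its determinant (the product of its eigenvalues; equivalently, $|A|^\beta$ is the determinant of the real linear map $x\mapsto Ax$ on $\mathfrak F^n$). Let $(dX)$ be Lebesgue measure on $\mathfrak F^{m\times n}$ in the $\beta mn$ real coordinates, and $(dS)$ Lebesgue measure on the Hermitian matrices in the real diagonal entries and the real coordinates of the entries above the diagonal. Put $$\Gamma_n^\beta[a]=\int_{\mathfrak P_n^\beta}\operatorname{etr}(-A)\,|A|^{a-(n-1)\beta/2-1}(dA),\qquad a>(n-1)\beta/2 .$$ Define the following laws. * $\mathcal N_{m\times n}^\beta(M,A\otimes B)$, for $M\in\mathfrak F^{m\times n}$, $A\in\mathfrak P_m^\beta$,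 $B\in\mathfrak P_n^\beta$, has density with respect to $(dY)$ $$\frac{\operatorname{etr}\{-\tfrac{\beta}{2}A^{-1}(Y-M)B^{-1}(Y-M)^*\}}{(2\pi/\beta)^{\beta mn/2}|A|^{\beta n/2}|B|^{\beta m/2}} .$$ * $\mathcal W_n^\beta(N,S)$, for $N>n-1$ and $S\in\mathfrak P_n^\beta$, has density with respect to $(dV)$ on $\mathfrak P_n^\beta$ $$\frac{|V|^{\beta(N-n+1)/2-1}\operatorname{etr}\{-\tfrac{\beta}{2}S^{-1}V\}}{(2/\beta)^{\beta nN/2}\,\Gamma_n^\beta[\beta N/2]\,|S|^{\beta N/2}} .$$ * $\mathcal T_{m\times n}^\beta(\nu,\mu,\Xi,\Sigma)$, for $\nu>m-1$, $\mu\in\mathfrak F^{m\times n}$, $\Xi\in\mathfrak P_m^\beta$, $\Sigma\in\mathfrak P_n^\beta$, has density with respect to $(dT)$ $$\frac{\Gamma_m^\beta[\beta(n+\nu)/2]}{\pi^{mn\beta/2}\,\Gamma_m^\beta[\beta\nu/2]\,|\Xi|^{\beta\nu/2}|\Sigma|^{\beta m/2}}\;\bigl|\Xi^{-1}+(T-\mu)\Sigma^{-1}(T-\mu)^*\bigr|^{-\beta(n+\nu)/2}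 .$$ Let $\nu>m-1$ be real, $\mu\in\mathfrak F^{m\times n}$, $\Xi\in\mathfrak P_m^\beta$ and $\Sigma\in\mathfrak P_n^\beta$. Let $X\sim\mathcal N_{m\times n}^\beta(0,\Xi^{-1}\otimes I_n)$ and $U\sim\mathcal W_n^\beta(\nu+n-m,\Sigma^{-1})$ be random matrices on one probability space, and let $L_1$ be any random $n\times n$ matrix over $\mathfrak F$ that is a square root of $U$, in the sense that $L_1L_1^*=U$ almost surely, and that is independent of $X$ (for example, $U$ is independent of $X$ and $L_1$ is a measurable function of $U$). Then $$T=XL_1^{-1}+\mu\;\sim\;\mathcal T_{m\times n}^\beta(\nu,\mu,\Xi,\Sigma).$$ -/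

import Mathlib

open MeasureTheory ProbabilityTheory

open scoped Matrix

noncomputable section

namespace NDA

/-- `F` is an (associative) real normed division algebra with its conjugation `star`: the norm is
multiplicative (`NormedDivisionRing`), Euclidean (`InnerProductSpace`), multiplication is real
bilinear and `star a * a = ‖a‖²`. In finite dimension these are exactly `ℝ`, `ℂ` and the
quaternions, see the three instances below. -/
class RealNormedDivisionAlgebra (F : Type*) [NormedDivisionRing F] [StarRing F]
    [InnerProductSpace ℝ F] : Prop where
  smul_mul (r : ℝ) (a b : F) : (r • a) * b = r • (a * b)
  mul_smul (r : ℝ) (a b : F) : a * (r • b) = r • (a * b)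
  star_mul_self (a : F) : star a * a = (‖a‖ ^ 2) • (1 : F)

instance : RealNormedDivisionAlgebra ℝ where
  smul_mul r a b := by simp [mul_assoc]
  mul_smul r a b := by simp [mul_left_comm]
  star_mul_self a := by simp [sq]

instance : RealNormedDivisionAlgebra ℂ where
  smul_mul r a b := by simp [mul_assoc]
  mul_smul r a b := by simp [mul_left_comm]
  star_mul_self a := by
    rw [Complex.star_def, ← Complex.normSq_eq_conj_mul_self, Complex.normSq_eq_norm_sq]
    simp

instance : RealNormedDivisionAlgebra (Quaternion ℝ) where
  smul_mul r a b := by simp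
  mul_smul r a b := by simp
  star_mul_self a := by
    rw [Quaternion.star_mul_self, Quaternion.normSq_eq_norm_mul_self, ← sq,
      ← Algebra.algebraMap_eq_smul_one]
    rfl

instance matrixMeasurableSpace {m n F : Type*} [MeasurableSpace F] :
    MeasurableSpace (Matrix m n F) :=
  inferInstanceAs (MeasurableSpace (m → n → F))

section Algebra

variable (F : Type*) [NormedDivisionRing F] [StarRing F] [InnerProductSpace ℝ F]

/-- The real dimension `β` of `F`, as a real number. -/
def rdim : ℝ := (Module.finrank ℝ F : ℝ)

variable {F}

/-- The real part of the trace; `etr A = exp (retr A)`. -/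
def retr {n : ℕ} (A : Matrix (Fin n) (Fin n) F) : ℝ := inner ℝ (1 : F) A.trace

/-- The cone of positive definite Hermitian matrices over `F`. -/
def IsPosDef {n : ℕ} (A : Matrix (Fin n) (Fin n) F) : Prop :=
  A.IsHermitian ∧ ∀ x : Fin n → F, x ≠ 0 → 0 < inner ℝ (1 : F) (star x ⬝ᵥ (A *ᵥ x))

variable [RealNormedDivisionAlgebra F]

/-- The real linear endomorphism `x ↦ A x` of `Fⁿ`. -/
def realLin {n : ℕ} (A : Matrix (Fin n) (Fin n) F) : (Fin n → F) →ₗ[ℝ] (Fin n → F) where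
  toFun x := A *ᵥ x
  map_add' x y := Matrix.mulVec_add A x y
  map_smul' r x := by
    funext i
    simp [Matrix.mulVec, dotProduct, Finset.smul_sum, RealNormedDivisionAlgebra.mul_smul]

/-- The determinant `|A|` of a positive definite matrix over `F` (more generally, the absolute
value of the determinant): the real determinant of `x ↦ A x` on `Fⁿ` is `|A| ^ β`. Over `ℝ` and `ℂ`
this is the modulus of the usual determinant, over the quaternions it is the normalized Dieudonné
determinant (the square root of the Study determinant), which on positive definite matrices is
the Moore determinant, the product of the eigenvalues. -/
def detF {n : ℕ} (A : Matrix (Fin n) (Fin n) F) : ℝ :=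
  |LinearMap.det (realLin A)| ^ (1 / rdim F)

end Algebra

section Measures

variable (F : Type*) [NormedDivisionRing F] [StarRing F] [InnerProductSpace ℝ F]
  [FiniteDimensional ℝ F] [MeasurableSpace F] [BorelSpace F]

/-- Lebesgue measure `(dX)` on the `m × n` matrices over `F`. -/
def matVolume (m n : ℕ) : Measure (Matrix (Fin m) (Fin n) F) :=
  Measure.pi fun _ : Fin m => Measure.pi fun _ : Fin n => (volume : Measure F)

variable {F}

/-- The Hermitian matrix with real diagonal `d` and entries `z` above the diagonal. -/
def hermOf {n : ℕ} (p : (Fin n → ℝ) × ({q : Fin n × Fin n // q.1 < q.2} → F)) :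
    Matrix (Fin n) (Fin n) F :=
  fun i j =>
    if h : i < j then p.2 ⟨(i, j), h⟩
    else if h : j < i then star (p.2 ⟨(j, i), h⟩)
    else p.1 i • (1 : F)

variable (F)

/-- Lebesgue measure `(dS)` on the Hermitian matrices: the product of the Lebesgue measures of the
real diagonal entries and of the entries above the diagonal. -/
def hermVolume (n : ℕ) : Measure (Matrix (Fin n) (Fin n) F) :=
  ((Measure.pi fun _ : Fin n => (volume : Measure ℝ)).prod
    (Measure.pi fun _ : {q : Fin n × Fin n // q.1 < q.2} => (volume : Measure F))).map hermOf

variable [RealNormedDivisionAlgebra F]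

/-- The multivariate Gamma function `Γ_n^β[a]`. -/
def mvGamma (n : ℕ) (a : ℝ) : ℝ :=
  ∫ A in {A : Matrix (Fin n) (Fin n) F | IsPosDef A},
    Real.exp (-retr A) * detF A ^ (a - ((n : ℝ) - 1) * rdim F / 2 - 1) ∂(hermVolume F n)

variable {F}

/-- The matrix normal law `N_{m×n}^β(M, A ⊗ B)`. -/
def matrixNormal {m n : ℕ} (M : Matrix (Fin m) (Fin n) F) (A : Matrix (Fin m) (Fin m) F)
    (B : Matrix (Fin n) (Fin n) F) : Measure (Matrix (Fin m) (Fin n) F) :=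
  (matVolume F m n).withDensity fun Y => ENNReal.ofReal
    (1 / ((2 * Real.pi / rdim F) ^ (rdim F * m * n / 2)
        * detF A ^ (rdim F * n / 2) * detF B ^ (rdim F * m / 2))
      * Real.exp (-(rdim F / 2 *
          retr (Ring.inverse A * (Y - M) * Ring.inverse B * (Y - M)ᴴ))))

/-- The Wishart law `W_n^β(N, S)`, supported on the positive definite matrices. -/
def wishart {n : ℕ} (N : ℝ) (S : Matrix (Fin n) (Fin n) F) : Measure (Matrix (Fin n) (Fin n) F) :=
  ((hermVolume F n).restrict {V | IsPosDef V}).withDensity fun V => ENNReal.ofReal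
    (1 / ((2 / rdim F) ^ (rdim F * n * N / 2) * mvGamma F n (rdim F * N / 2)
        * detF S ^ (rdim F * N / 2))
      * detF V ^ (rdim F * (N - n + 1) / 2 - 1)
      * Real.exp (-(rdim F / 2 * retr (Ring.inverse S * V))))

/-- The matricvariate `T` law `T_{m×n}^β(ν, μ, Ξ, S)`. -/
def matricvariateT {m n : ℕ} (ν : ℝ) (μ : Matrix (Fin m) (Fin n) F)
    (Ξ : Matrix (Fin m) (Fin m) F) (S : Matrix (Fin n) (Fin n) F) :
    Measure (Matrix (Fin m) (Fin n) F) :=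
  (matVolume F m n).withDensity fun T => ENNReal.ofReal
    (mvGamma F m (rdim F * (n + ν) / 2)
        / (Real.pi ^ (m * n * rdim F / 2) * mvGamma F m (rdim F * ν / 2)
          * detF Ξ ^ (rdim F * ν / 2) * detF S ^ (rdim F * m / 2))
      * detF (Ring.inverse Ξ + (T - μ) * Ring.inverse S * (T - μ)ᴴ) ^ (-(rdim F * (n + ν) / 2)))

end Measures

end NDA

end

set_option linter.unusedSectionVars false

noncomputable section

namespace NDA

/-! ### Conjugation, norm and real part in a normed division algebra -/

section Scalars

variable {F : Type*} [NormedDivisionRing F] [StarRing F] [InnerProductSpace ℝ F]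
  [RealNormedDivisionAlgebra F]

/-! Fix an invertible `L`. The substitution X = (T - μ)L multiplies Lebesgue measure by |L|^(βm) =
|LLᴴ|^(βm/2), and the normal exponent becomes Re tr(Ξ(T-μ)LLᴴ(T-μ)ᴴ). The conditional density of
XL⁻¹ + μ thus depends on L only through LLᴴ, so any square root of U will do
(`lintegral_matrixNormal`). Averaging over the Wishart law of U = V leaves, for each T, the integral
of |V|^(a-(n-1)β/2-1) etr(-AV), where a = β(n+ν)/2 and A = (β/2)(S + (T-μ)ᴴΞ(T-μ)). This is Γ_n[a]
|A|^(-a) (`lintegral_exp_retr_mul`), and Sylvester's identity turns |A| into a constant times |Ξ⁻¹ +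
(T-μ)S⁻¹(T-μ)ᴴ| (`detF_add_conj_comm`).

The constants are never compared by calculation. The law of T and the claimed law are multiples of
one kernel and both have mass 1, so they agree. The mass of the claimed law comes from
`lgamma_mul_lintegral`: write |M + TNTᴴ|^(-a) as a Gamma integral over V, exchange integrals, and do
the Gaussian integral in T.

Two points need care uniformly in β. The Jacobian of V ↦ uVuᴴ is obtained by Gaussian elimination:
multiplicative characters are trivial on unipotent row operations, so only positive diagonal
matrices have to be computed. Finiteness of Γ_m[a] on the whole range a > (m-1)β/2 is obtained
without its product formula, from the column case n = 1 of `lgamma_mul_lintegral`, which relates a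
to a + β/2 (`lgamma_step`). -/

instance : IsScalarTower ℝ F F := ⟨fun r a b => RealNormedDivisionAlgebra.smul_mul r a b⟩

instance : SMulCommClass ℝ F F := ⟨fun r a b => (RealNormedDivisionAlgebra.mul_smul r a b).symm⟩

theorem star_mul_add_star_mul (a b : F) :
    star a * b + star b * a = (2 * inner ℝ a b) • (1 : F) := by
  have h := RealNormedDivisionAlgebra.star_mul_self (a + b)
  rw [norm_add_sq_real, star_add, add_mul, mul_add, mul_add,
    RealNormedDivisionAlgebra.star_mul_self a, RealNormedDivisionAlgebra.star_mul_self b,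
    add_smul, add_smul] at h
  rw [← sub_eq_zero] at h ⊢
  rw [← h]
  abel

/-- Polarizing `star a * a = ‖a‖²` against 1 shows that conjugation is reflection in the real line,
hence determined by the Euclidean structure. Its real linearity, isometry and continuity all come
from this formula. -/
theorem star_eq (a : F) : star a = (2 * inner ℝ (1 : F) a) • (1 : F) - a := by
  have h := star_mul_add_star_mul (1 : F) a
  simp only [star_one, one_mul, mul_one] at h
  rw [← h]; abel

instance : StarModule ℝ F where
  star_smul r a := by
    rw [star_eq, star_eq a, inner_smul_right, smul_sub, smul_smul]
    simp only [star_trivial]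
    congr 2; ring

theorem inner_one_one : inner ℝ (1 : F) 1 = 1 := by
  rw [real_inner_self_eq_norm_sq]; simp

theorem inner_star_star (a b : F) : inner ℝ (star a) (star b) = inner ℝ a b := by
  rw [star_eq, star_eq b]
  simp only [inner_sub_left, inner_sub_right, inner_smul_left, inner_smul_right, inner_one_one,
    real_inner_comm (1 : F) a]
  simp; ring

theorem inner_one_star (a : F) : inner ℝ (1 : F) (star a) = inner ℝ (1 : F) a := by
  simpa using inner_star_star (1 : F) a

theorem norm_star_eq (a : F) : ‖star a‖ = ‖a‖ := by
  have h := inner_star_star a a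
  rw [real_inner_self_eq_norm_sq, real_inner_self_eq_norm_sq] at h
  exact (pow_left_inj₀ (norm_nonneg _) (norm_nonneg _) two_ne_zero).1 h

theorem inner_eq (a b : F) : inner ℝ a b = inner ℝ (1 : F) (star a * b) := by
  have h := congrArg (inner ℝ (1 : F)) (star_mul_add_star_mul a b)
  rw [inner_add_right, ← inner_one_star (star b * a), star_mul, star_star, inner_smul_right,
    inner_one_one] at h
  linarith

theorem inner_mul_left (a b c : F) : inner ℝ (a * b) c = inner ℝ b (star a * c) := by
  rw [inner_eq, inner_eq b, star_mul, mul_assoc]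

/-- Only the real part is insensitive to order over the quaternions; this is what makes `retr`
cyclic. -/
theorem inner_one_mul_comm (a b : F) : inner ℝ (1 : F) (a * b) = inner ℝ (1 : F) (b * a) := by
  have h1 := inner_eq (star a) b
  have h2 := inner_eq (star b) a
  rw [star_star] at h1 h2
  rw [← h1, ← h2, ← inner_star_star, star_star, real_inner_comm]

theorem inner_one_star_mul_self (a : F) : inner ℝ (1 : F) (star a * a) = ‖a‖ ^ 2 := by
  rw [← inner_eq, real_inner_self_eq_norm_sq]

theorem mul_star_self_eq (a : F) : a * star a = (‖a‖ ^ 2) • (1 : F) := by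
  simpa [norm_star_eq] using RealNormedDivisionAlgebra.star_mul_self (star a)

theorem eq_smul_one_of_star_eq {a : F} (h : star a = a) : a = (inner ℝ (1 : F) a) • (1 : F) := by
  have h1 := star_eq a
  rw [h] at h1
  have h2 : (2 : ℝ) • a = (2 : ℝ) • ((inner ℝ (1 : F) a) • (1 : F)) := by
    rw [smul_smul, two_smul]; nth_rw 1 [h1]; abel
  exact smul_right_injective F (two_ne_zero : (2 : ℝ) ≠ 0) h2

variable (F) in
theorem rdim_pos [FiniteDimensional ℝ F] : 0 < rdim F := by
  unfold rdim
  exact_mod_cast Module.finrank_pos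

end Scalars

/-! ### Real trace and normalized determinant -/

section Matrices

variable {F : Type*} [NormedDivisionRing F] [StarRing F] [InnerProductSpace ℝ F]

theorem retr_eq_sum {n : ℕ} (A : Matrix (Fin n) (Fin n) F) :
    retr A = ∑ i, inner ℝ (1 : F) (A i i) := by
  simp [retr, Matrix.trace, inner_sum]

theorem retr_add {n : ℕ} (A B : Matrix (Fin n) (Fin n) F) : retr (A + B) = retr A + retr B := by
  simp [retr, inner_add_right]

theorem retr_smul {n : ℕ} (r : ℝ) (A : Matrix (Fin n) (Fin n) F) :
    retr (r • A) = r * retr A := by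
  simp [retr, inner_smul_right]

variable [RealNormedDivisionAlgebra F]

theorem retr_mul_comm {m n : ℕ} (A : Matrix (Fin m) (Fin n) F) (B : Matrix (Fin n) (Fin m) F) :
    retr (A * B) = retr (B * A) := by
  simp only [retr_eq_sum, Matrix.mul_apply, inner_sum]
  rw [Finset.sum_comm]
  exact Finset.sum_congr rfl fun i _ => Finset.sum_congr rfl fun j _ => inner_one_mul_comm _ _

theorem retr_mul_conjTranspose_self {m n : ℕ} (A : Matrix (Fin m) (Fin n) F) :
    retr (A * Aᴴ) = ∑ i, ∑ j, ‖A i j‖ ^ 2 := by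
  simp only [retr_eq_sum, Matrix.mul_apply, inner_sum, Matrix.conjTranspose_apply,
    mul_star_self_eq, inner_smul_right, inner_one_one, mul_one]

/-- The real linear map `x ↦ A x` of a rectangular matrix. -/
def rectLin {m n : ℕ} (A : Matrix (Fin m) (Fin n) F) : (Fin n → F) →ₗ[ℝ] (Fin m → F) where
  toFun x := A *ᵥ x
  map_add' x y := Matrix.mulVec_add A x y
  map_smul' r x := Matrix.mulVec_smul A r x

theorem rectLin_mul {l m n : ℕ} (A : Matrix (Fin l) (Fin m) F) (B : Matrix (Fin m) (Fin n) F) :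
    rectLin (A * B) = rectLin A ∘ₗ rectLin B := by
  refine LinearMap.ext fun x => ?_
  exact (Matrix.mulVec_mulVec x A B).symm

theorem realLin_one {n : ℕ} : realLin (1 : Matrix (Fin n) (Fin n) F) = LinearMap.id := by
  refine LinearMap.ext fun x => ?_
  exact Matrix.one_mulVec x

theorem realLin_mul {n : ℕ} (A B : Matrix (Fin n) (Fin n) F) :
    realLin (A * B) = realLin A ∘ₗ realLin B := rectLin_mul A B

theorem realLin_one_add_mul {m n : ℕ} (A : Matrix (Fin m) (Fin n) F)
    (B : Matrix (Fin n) (Fin m) F) :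
    realLin (1 + A * B) = LinearMap.id + rectLin A ∘ₗ rectLin B := by
  refine LinearMap.ext fun x => ?_
  change (1 + A * B) *ᵥ x = x + A *ᵥ (B *ᵥ x)
  rw [Matrix.add_mulVec, Matrix.one_mulVec, Matrix.mulVec_mulVec]

theorem detF_nonneg {n : ℕ} (A : Matrix (Fin n) (Fin n) F) : 0 ≤ detF A :=
  Real.rpow_nonneg (abs_nonneg _) _

theorem detF_mul {n : ℕ} (A B : Matrix (Fin n) (Fin n) F) : detF (A * B) = detF A * detF B := by
  rw [detF, realLin_mul, LinearMap.det_comp, abs_mul, Real.mul_rpow (abs_nonneg _) (abs_nonneg _)]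
  rfl

theorem detF_one {n : ℕ} : detF (1 : Matrix (Fin n) (Fin n) F) = 1 := by
  simp [detF, realLin_one]

theorem detF_pos_of_isUnit {n : ℕ} {A : Matrix (Fin n) (Fin n) F} (h : IsUnit A) : 0 < detF A := by
  obtain ⟨u, rfl⟩ := h
  refine lt_of_le_of_ne (detF_nonneg _) fun h0 => ?_
  have h1 := detF_mul (u : Matrix (Fin n) (Fin n) F) ↑u⁻¹
  rw [Units.mul_inv, detF_one, ← h0, zero_mul] at h1
  exact one_ne_zero h1

theorem detF_inverse {n : ℕ} (A : Matrix (Fin n) (Fin n) F) (h : IsUnit A) :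
    detF (Ring.inverse A) = (detF A)⁻¹ := by
  rw [← mul_eq_one_iff_eq_inv₀ (detF_pos_of_isUnit h).ne', ← detF_mul, Ring.inverse_mul_cancel _ h,
    detF_one]

variable [FiniteDimensional ℝ F]

theorem detF_rpow_rdim {n : ℕ} (A : Matrix (Fin n) (Fin n) F) :
    detF A ^ rdim F = |LinearMap.det (realLin A)| := by
  rw [detF, ← Real.rpow_mul (abs_nonneg _), one_div_mul_cancel (rdim_pos F).ne', Real.rpow_one]

/-- Sylvester's identity is inherited from real matrices: in real bases `A` and `B` become
rectangular real matrices of sizes βm × βn and βn × βm. -/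
theorem detF_one_add_mul_comm {m n : ℕ} (A : Matrix (Fin m) (Fin n) F)
    (B : Matrix (Fin n) (Fin m) F) : detF (1 + A * B) = detF (1 + B * A) := by
  classical
  have key : ∀ {k l : ℕ} (A : Matrix (Fin k) (Fin l) F) (B : Matrix (Fin l) (Fin k) F),
      LinearMap.det (realLin (1 + A * B)) =
        (1 + LinearMap.toMatrix (Module.finBasis ℝ (Fin l → F)) (Module.finBasis ℝ (Fin k → F))
              (rectLin A) *
            LinearMap.toMatrix (Module.finBasis ℝ (Fin k → F)) (Module.finBasis ℝ (Fin l → F))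
              (rectLin B)).det := by
    intro k l A B
    rw [realLin_one_add_mul, ← LinearMap.det_toMatrix (Module.finBasis ℝ (Fin k → F)), map_add,
      LinearMap.toMatrix_id, LinearMap.toMatrix_comp _ (Module.finBasis ℝ (Fin l → F))]
  rw [detF, detF, key, key, Matrix.det_one_add_mul_comm]

/-- `Aᴴ` acts as the real adjoint of `A` for the Euclidean inner product, and adjoints have equal
real determinant. The passage to `PiLp 2` supplies that inner product in place of the sup norm. -/
theorem detF_conjTranspose {n : ℕ} (A : Matrix (Fin n) (Fin n) F) : detF Aᴴ = detF A := by
  classical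
  let e := (WithLp.linearEquiv 2 ℝ (Fin n → F)).symm
  let f : Matrix (Fin n) (Fin n) F →
      (PiLp 2 (fun _ : Fin n => F) →ₗ[ℝ] PiLp 2 (fun _ : Fin n => F)) := fun A =>
    (e : (Fin n → F) →ₗ[ℝ] _) ∘ₗ realLin A ∘ₗ (e.symm : _ →ₗ[ℝ] (Fin n → F))
  have hdet : ∀ A, LinearMap.det (f A) = LinearMap.det (realLin A) := fun A =>
    LinearMap.det_conj (realLin A) e
  have hadj : f Aᴴ = LinearMap.adjoint (f A) := by
    rw [LinearMap.eq_adjoint_iff]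
    intro x y
    change inner ℝ (WithLp.toLp 2 (Aᴴ *ᵥ x.ofLp)) y = inner ℝ x (WithLp.toLp 2 (A *ᵥ y.ofLp))
    simp only [PiLp.inner_apply, Matrix.mulVec, dotProduct, inner_sum, sum_inner]
    rw [Finset.sum_comm]
    refine Finset.sum_congr rfl fun i _ => Finset.sum_congr rfl fun j _ => ?_
    rw [Matrix.conjTranspose_apply, inner_mul_left, star_star]
  let b := stdOrthonormalBasis ℝ (PiLp 2 (fun _ : Fin n => F))
  rw [detF, detF, ← hdet, ← hdet, hadj, ← LinearMap.det_toMatrix b.toBasis,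
    ← LinearMap.det_toMatrix b.toBasis, LinearMap.toMatrix_adjoint, Matrix.det_conjTranspose]
  simp

end Matrices

/-! ### Positive definite matrices and symmetric elimination -/

section Elimination

variable {F : Type*} [NormedDivisionRing F] [StarRing F] [InnerProductSpace ℝ F]
  [RealNormedDivisionAlgebra F] {n : ℕ}

theorem IsPosDef.conj {A : Matrix (Fin n) (Fin n) F} (hA : IsPosDef A)
    (u : (Matrix (Fin n) (Fin n) F)ˣ) :
    IsPosDef ((u : Matrix (Fin n) (Fin n) F)ᴴ * A * (u : Matrix (Fin n) (Fin n) F)) := by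
  refine ⟨Matrix.isHermitian_conjTranspose_mul_mul _ hA.1, fun x hx => ?_⟩
  have hux : (u : Matrix (Fin n) (Fin n) F) *ᵥ x ≠ 0 := by
    intro h
    apply hx
    have h2 := congrArg (fun y => (↑u⁻¹ : Matrix (Fin n) (Fin n) F) *ᵥ y) h
    simpa [Matrix.mulVec_mulVec] using h2
  have h := hA.2 _ hux
  rwa [Matrix.star_mulVec, ← Matrix.dotProduct_mulVec, Matrix.mulVec_mulVec,
    Matrix.mulVec_mulVec] at h

theorem isPosDef_one : IsPosDef (1 : Matrix (Fin n) (Fin n) F) := by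
  refine ⟨Matrix.isHermitian_one, fun x hx => ?_⟩
  rw [Matrix.one_mulVec, dotProduct, inner_sum]
  simp only [Pi.star_apply, inner_one_star_mul_self]
  obtain ⟨i, hi⟩ := Function.ne_iff.1 hx
  exact Finset.sum_pos' (fun i _ => by positivity)
    ⟨i, Finset.mem_univ _, pow_pos (norm_pos_iff.2 hi) 2⟩

theorem IsPosDef.diag_pos {A : Matrix (Fin n) (Fin n) F} (hA : IsPosDef A) (k : Fin n) :
    0 < inner ℝ (1 : F) (A k k) := by
  have h := hA.2 (Pi.single k 1) (by simp)
  simpa [← Pi.single_star] using h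

theorem _root_.Matrix.IsHermitian.diag_eq {A : Matrix (Fin n) (Fin n) F} (hA : A.IsHermitian)
    (k : Fin n) : A k k = (inner ℝ (1 : F) (A k k)) • (1 : F) :=
  eq_smul_one_of_star_eq (hA.apply k k)

/-- The invertible real diagonal matrix with nonzero entries `d`. -/
def diagUnit (d : Fin n → ℝ) (hd : ∀ i, d i ≠ 0) : (Matrix (Fin n) (Fin n) F)ˣ where
  val := Matrix.diagonal fun i => d i • (1 : F)
  inv := Matrix.diagonal fun i => (d i)⁻¹ • (1 : F)
  val_inv := by
    rw [Matrix.diagonal_mul_diagonal, ← Matrix.diagonal_one]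
    congr 1; funext i
    simp [smul_smul, hd i]
  inv_val := by
    rw [Matrix.diagonal_mul_diagonal, ← Matrix.diagonal_one]
    congr 1; funext i
    simp [smul_smul, hd i]

/-- The matrix whose only nonzero row is the `k`-th one, with entries `c` off the diagonal. -/
def rowMatrix (k : Fin n) (c : Fin n → F) : Matrix (Fin n) (Fin n) F :=
  fun i j => if i = k then (if j = k then 0 else c j) else 0

theorem rowMatrix_mul_self (k : Fin n) (c : Fin n → F) : rowMatrix k c * rowMatrix k c = 0 := by
  ext i j
  rw [Matrix.mul_apply]
  refine Finset.sum_eq_zero fun l _ => ?_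
  by_cases hl : l = k <;> simp [rowMatrix, hl]

/-- The unipotent matrix `1 + rowMatrix k c`. -/
def rowUnit (k : Fin n) (c : Fin n → F) : (Matrix (Fin n) (Fin n) F)ˣ where
  val := 1 + rowMatrix k c
  inv := 1 - rowMatrix k c
  val_inv := by
    have h := rowMatrix_mul_self k c
    rw [add_mul, mul_sub, mul_sub, h]; simp
  inv_val := by
    have h := rowMatrix_mul_self k c
    rw [sub_mul, mul_add, mul_add, h]; simp

/-- A multiplicative character is trivial on the unipotent matrices `1 + rowMatrix k c`. -/
theorem map_rowUnit (φ : (Matrix (Fin n) (Fin n) F)ˣ →* ℝ) (k : Fin n) (c : Fin n → F) :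
    φ (rowUnit k c) = 1 := by
  -- Doubling the k-th coordinate conjugates R = `rowUnit k c` into R², since the row is doubled
  -- while its k-th entry vanishes. Hence φ(R) = φ(R)², and φ(R) = 1.
  let d : Fin n → ℝ := fun i => if i = k then 2 else 1
  have hd : ∀ i, d i ≠ 0 := fun i => by dsimp only [d]; split_ifs <;> norm_num
  let D : (Matrix (Fin n) (Fin n) F)ˣ := diagUnit d hd
  have h1 : (D : Matrix (Fin n) (Fin n) F) * rowMatrix k c = rowMatrix k c + rowMatrix k c := by
    ext i j
    simp only [D, diagUnit, Matrix.diagonal_mul, Matrix.add_apply]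
    by_cases hi : i = k <;> by_cases hj : j = k <;> simp [rowMatrix, d, hi, hj, two_smul, add_mul]
  have h2 : rowMatrix k c * (D : Matrix (Fin n) (Fin n) F) = rowMatrix k c := by
    ext i j
    simp only [D, diagUnit, Matrix.mul_diagonal]
    by_cases hi : i = k <;> by_cases hj : j = k <;> simp [rowMatrix, d, hi, hj]
  have h : D * rowUnit k c = rowUnit k c * rowUnit k c * D := by
    apply Units.ext
    simp only [Units.val_mul, rowUnit]
    simp only [mul_add, add_mul, mul_one, one_mul, rowMatrix_mul_self, h1, h2, add_zero]
    abel
  have h3 := congrArg φ h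
  simp only [map_mul] at h3
  have hD : φ D ≠ 0 := ((Group.isUnit D).map φ).ne_zero
  have hr : φ (rowUnit k c) ≠ 0 := ((Group.isUnit (rowUnit k c)).map φ).ne_zero
  have h4 : (φ D * φ (rowUnit k c)) * φ (rowUnit k c) = (φ D * φ (rowUnit k c)) * 1 := by
    rw [mul_one]; linear_combination -h3
  exact mul_left_cancel₀ (mul_ne_zero hD hr) h4

/-- Symmetric Gaussian elimination: a positive definite matrix can be reduced to the identity by a
congruence on which two given characters agree, provided they agree on positive real diagonal
matrices. -/
theorem IsPosDef.exists_conj_eq_one {A : Matrix (Fin n) (Fin n) F} (hA : IsPosDef A)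
    (φ ψ : (Matrix (Fin n) (Fin n) F)ˣ →* ℝ)
    (hφψ : ∀ (d : Fin n → ℝ) (hd : ∀ i, 0 < d i),
      φ (diagUnit d fun i => (hd i).ne') = ψ (diagUnit d fun i => (hd i).ne')) :
    ∃ u : (Matrix (Fin n) (Fin n) F)ˣ, φ u = ψ u ∧
      (u : Matrix (Fin n) (Fin n) F)ᴴ * A * u = 1 := by
  -- The induction is on the set of columns that already agree with the identity.
  suffices h : ∀ s : Finset (Fin n), ∃ u : (Matrix (Fin n) (Fin n) F)ˣ, φ u = ψ u ∧
      ∀ j ∈ s, ∀ i, ((u : Matrix (Fin n) (Fin n) F)ᴴ * A * u) i j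
        = (1 : Matrix (Fin n) (Fin n) F) i j by
    obtain ⟨u, hu, h⟩ := h Finset.univ
    exact ⟨u, hu, Matrix.ext fun i j => h j (Finset.mem_univ _) i⟩
  intro s
  induction s using Finset.induction_on with
  | empty => exact ⟨1, by simp, by simp⟩
  | insert k s hk ih =>
    obtain ⟨u, hu, hs⟩ := ih
    have hB := hA.conj u
    generalize hBdef : (u : Matrix (Fin n) (Fin n) F)ᴴ * A * u = B at hs hB
    obtain ⟨a, ha, hakk⟩ : ∃ a : ℝ, 0 < a ∧ B k k = a • (1 : F) :=
      ⟨_, hB.diag_pos k, hB.1.diag_eq k⟩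
    -- The pivot is a positive real scalar, so it commutes with everything; this `c` clears row k
    -- off the diagonal.
    let c : Fin n → F := fun j => -(a⁻¹ • B k j)
    let C : (Matrix (Fin n) (Fin n) F)ˣ := rowUnit k c
    have hBC : ∀ i j, (B * (C : Matrix (Fin n) (Fin n) F)) i j
        = if j = k then B i j else B i j - a⁻¹ • (B i k * B k j) := by
      intro i j
      have : (B * rowMatrix k c) i j = if j = k then 0 else -(a⁻¹ • (B i k * B k j)) := by
        rw [Matrix.mul_apply, Finset.sum_eq_single k]
        · by_cases hj : j = k <;> simp [rowMatrix, hj, c, mul_smul_comm]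
        · intro l _ hl; simp [rowMatrix, hl]
        · simp
      simp only [C, rowUnit, mul_add, mul_one, Matrix.add_apply, this]
      split_ifs
      · simp
      · rw [sub_eq_add_neg]
    have hBCk : ∀ j, j ≠ k → (B * (C : Matrix (Fin n) (Fin n) F)) k j = 0 := by
      intro j hj
      rw [hBC, if_neg hj, hakk]
      simp [smul_smul, ha.ne']
    have hM : ∀ i j, ((C : Matrix (Fin n) (Fin n) F)ᴴ * (B * C)) i j
        = (B * (C : Matrix (Fin n) (Fin n) F)) i j
          + (if i = k then 0 else star (c i) * (B * (C : Matrix (Fin n) (Fin n) F)) k j) := by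
      intro i j
      have : ((rowMatrix k c)ᴴ * (B * (C : Matrix (Fin n) (Fin n) F))) i j
          = if i = k then 0 else star (c i) * (B * (C : Matrix (Fin n) (Fin n) F)) k j := by
        rw [Matrix.mul_apply, Finset.sum_eq_single k]
        · by_cases hi : i = k <;> simp [rowMatrix, hi]
        · intro l _ hl; simp [rowMatrix, hl]
        · simp
      rw [← this]
      conv_lhs => rw [show (C : Matrix (Fin n) (Fin n) F)ᴴ = 1 + (rowMatrix k c)ᴴ by
        simp [C, rowUnit]]
      rw [add_mul, one_mul, Matrix.add_apply]
    have hMH := (hB.conj C).1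
    rw [Matrix.mul_assoc] at hMH
    -- Scaling by a^(-1/2) on both sides normalizes the pivot to 1.
    let d : Fin n → ℝ := fun i => if i = k then (Real.sqrt a)⁻¹ else 1
    have hd : ∀ i, 0 < d i := fun i => by dsimp only [d]; split_ifs <;> positivity
    let D : (Matrix (Fin n) (Fin n) F)ˣ := diagUnit d fun i => (hd i).ne'
    refine ⟨u * C * D, ?_, fun j hj i => ?_⟩
    · rw [map_mul, map_mul, map_mul, map_mul, hu, map_rowUnit, map_rowUnit, hφψ d hd]
    have hexp : ((↑(u * C * D) : Matrix (Fin n) (Fin n) F)ᴴ * A *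
        (↑(u * C * D) : Matrix (Fin n) (Fin n) F)) i j
        = (d i * d j) • ((C : Matrix (Fin n) (Fin n) F)ᴴ * (B * C)) i j := by
      have : (↑(u * C * D) : Matrix (Fin n) (Fin n) F)ᴴ * A * (↑(u * C * D) : Matrix (Fin n) (Fin n) F)
          = (D : Matrix (Fin n) (Fin n) F)ᴴ * ((C : Matrix (Fin n) (Fin n) F)ᴴ * (B * C)) * D := by
        rw [← hBdef]
        simp only [Units.val_mul, Matrix.conjTranspose_mul, Matrix.mul_assoc]
      rw [this]
      simp only [D, diagUnit, Matrix.diagonal_conjTranspose, Matrix.mul_diagonal,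
        Matrix.diagonal_mul]
      simp [smul_smul, mul_comm]
    rw [hexp]
    by_cases hjk : j = k
    · subst hjk
      by_cases hij : i = j
      · subst hij
        rw [hM, if_pos rfl, add_zero, hBC, if_pos rfl, hakk, smul_smul, Matrix.one_apply_eq]
        have : d i * d i * a = 1 := by
          simp only [d, if_true]
          rw [← mul_inv, Real.mul_self_sqrt ha.le, inv_mul_cancel₀ ha.ne']
        rw [this, one_smul]
      -- Row k has been cleared, and Hermitian symmetry clears column k.
      · rw [← hMH.apply i j, hM j i, if_pos rfl, add_zero, hBCk i hij, star_zero, smul_zero,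
          Matrix.one_apply_ne hij]
    · have hjs : j ∈ s := (Finset.mem_insert.1 hj).resolve_left hjk
      -- A finished column has zero in row k, so eliminating at k does not disturb it.
      have hkj : B k j = 0 := by rw [hs j hjs k, Matrix.one_apply_ne (Ne.symm hjk)]
      rw [hM, hBCk j hjk, mul_zero, ite_self, add_zero, hBC, if_neg hjk, hkj, mul_zero, smul_zero,
        sub_zero, hs j hjs i]
      by_cases hij : i = j
      · subst hij
        simp [d, hjk]
      · simp [Matrix.one_apply_ne hij]

theorem IsPosDef.exists_eq_conjTranspose_mul_self {A : Matrix (Fin n) (Fin n) F}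
    (hA : IsPosDef A) (φ ψ : (Matrix (Fin n) (Fin n) F)ˣ →* ℝ)
    (hφψ : ∀ (d : Fin n → ℝ) (hd : ∀ i, 0 < d i),
      φ (diagUnit d fun i => (hd i).ne') = ψ (diagUnit d fun i => (hd i).ne')) :
    ∃ u : (Matrix (Fin n) (Fin n) F)ˣ, φ u = ψ u ∧ A = (u : Matrix (Fin n) (Fin n) F)ᴴ * u := by
  obtain ⟨u, hu, h⟩ := hA.exists_conj_eq_one φ ψ hφψ
  refine ⟨u⁻¹, ?_, ?_⟩
  · have h1 : φ u⁻¹ * φ u = 1 := by rw [← map_mul]; simp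
    have h2 : ψ u⁻¹ * ψ u = 1 := by rw [← map_mul]; simp
    have h0 : φ u ≠ 0 := right_ne_zero_of_mul_eq_one h1
    rw [← hu] at h2
    exact mul_right_cancel₀ h0 (h1.trans h2.symm)
  · have hv : (↑u⁻¹ : Matrix (Fin n) (Fin n) F)ᴴ * (u : Matrix (Fin n) (Fin n) F)ᴴ = 1 := by
      rw [← Matrix.conjTranspose_mul, Units.mul_inv, Matrix.conjTranspose_one]
    calc A = ((↑u⁻¹ : Matrix (Fin n) (Fin n) F)ᴴ * (u : Matrix (Fin n) (Fin n) F)ᴴ) * A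
          * ((u : Matrix (Fin n) (Fin n) F) * ↑u⁻¹) := by rw [hv, Units.mul_inv]; simp
      _ = (↑u⁻¹ : Matrix (Fin n) (Fin n) F)ᴴ * ((u : Matrix (Fin n) (Fin n) F)ᴴ * A * u)
          * ↑u⁻¹ := by simp only [Matrix.mul_assoc]
      _ = _ := by rw [h, Matrix.mul_one]

theorem IsPosDef.exists_unit {A : Matrix (Fin n) (Fin n) F} (hA : IsPosDef A) :
    ∃ u : (Matrix (Fin n) (Fin n) F)ˣ, A = (u : Matrix (Fin n) (Fin n) F)ᴴ * u := by
  obtain ⟨u, -, h⟩ := hA.exists_eq_conjTranspose_mul_self 1 1 fun _ _ => rfl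
  exact ⟨u, h⟩

theorem isPosDef_conjTranspose_mul_self (u : (Matrix (Fin n) (Fin n) F)ˣ) :
    IsPosDef ((u : Matrix (Fin n) (Fin n) F)ᴴ * (u : Matrix (Fin n) (Fin n) F)) := by
  simpa using isPosDef_one.conj u

theorem IsPosDef.isUnit {A : Matrix (Fin n) (Fin n) F} (hA : IsPosDef A) : IsUnit A := by
  obtain ⟨u, rfl⟩ := hA.exists_unit
  exact (IsUnit.star u.isUnit).mul u.isUnit

theorem IsPosDef.detF_pos {A : Matrix (Fin n) (Fin n) F} (hA : IsPosDef A) : 0 < detF A :=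
  detF_pos_of_isUnit hA.isUnit

theorem IsPosDef.inverse {A : Matrix (Fin n) (Fin n) F} (hA : IsPosDef A) :
    IsPosDef (Ring.inverse A) := by
  obtain ⟨u, rfl⟩ := hA.exists_unit
  have h := isPosDef_conjTranspose_mul_self (star u⁻¹)
  convert! h using 1
  have h1 : ((u : Matrix (Fin n) (Fin n) F)ᴴ * u) = ((star u * u : (Matrix (Fin n) (Fin n) F)ˣ)) :=
    rfl
  rw [h1, Ring.inverse_unit, mul_inv_rev]
  simp [Matrix.star_eq_conjTranspose]

theorem IsPosDef.smul {A : Matrix (Fin n) (Fin n) F} (hA : IsPosDef A) {r : ℝ} (hr : 0 < r) :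
    IsPosDef (r • A) := by
  refine ⟨?_, fun x hx => ?_⟩
  · rw [Matrix.IsHermitian, Matrix.conjTranspose_smul, hA.1.eq, star_trivial]
  · rw [Matrix.smul_mulVec, dotProduct_smul, inner_smul_right]
    exact mul_pos hr (hA.2 x hx)

theorem IsPosDef.add_conj {k : ℕ} {A : Matrix (Fin n) (Fin n) F} (hA : IsPosDef A)
    {B : Matrix (Fin k) (Fin k) F} (hB : IsPosDef B) (T : Matrix (Fin n) (Fin k) F) :
    IsPosDef (A + T * B * Tᴴ) := by
  refine ⟨hA.1.add (Matrix.isHermitian_mul_mul_conjTranspose _ hB.1), fun x hx => ?_⟩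
  rw [Matrix.add_mulVec, dotProduct_add, inner_add_right]
  refine add_pos_of_pos_of_nonneg (hA.2 x hx) ?_
  have h : star x ⬝ᵥ ((T * B * Tᴴ) *ᵥ x) = star (Tᴴ *ᵥ x) ⬝ᵥ (B *ᵥ (Tᴴ *ᵥ x)) := by
    rw [Matrix.star_mulVec, Matrix.conjTranspose_conjTranspose, ← Matrix.dotProduct_mulVec,
      Matrix.mulVec_mulVec, Matrix.mulVec_mulVec]
  rw [h]
  by_cases h0 : Tᴴ *ᵥ x = 0
  · simp [h0]
  · exact (hB.2 _ h0).le

end Elimination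

/-! ### Jacobian of a congruence on Hermitian matrices -/

section HermitianCoordinates

variable {F : Type*} [NormedDivisionRing F] [StarRing F] [InnerProductSpace ℝ F]
  [RealNormedDivisionAlgebra F] {n : ℕ}

variable (F) in
/-- Real coordinates of Hermitian matrices: the diagonal and the entries above it. -/
abbrev HermCoord (n : ℕ) : Type _ := (Fin n → ℝ) × ({q : Fin n × Fin n // q.1 < q.2} → F)

theorem hermOf_of_lt (p : HermCoord F n) {i j : Fin n} (h : i < j) :
    hermOf p i j = p.2 ⟨(i, j), h⟩ := by simp [hermOf, h]

theorem hermOf_of_gt (p : HermCoord F n) {i j : Fin n} (h : j < i) :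
    hermOf p i j = star (p.2 ⟨(j, i), h⟩) := by simp [hermOf, h, h.not_gt]

theorem hermOf_diag (p : HermCoord F n) (i : Fin n) : hermOf p i i = p.1 i • (1 : F) := by
  simp [hermOf]

theorem hermOf_isHermitian (p : HermCoord F n) : (hermOf p).IsHermitian := by
  refine Matrix.IsHermitian.ext fun i j => ?_
  rcases lt_trichotomy i j with h | rfl | h
  · rw [hermOf_of_lt p h, hermOf_of_gt p h, star_star]
  · rw [hermOf_diag, star_smul, star_one, star_trivial]
  · rw [hermOf_of_gt p h, hermOf_of_lt p h]

variable (F n) in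
/-- `hermOf` as a real linear map. -/
def hermLin : HermCoord F n →ₗ[ℝ] Matrix (Fin n) (Fin n) F where
  toFun := hermOf
  map_add' p q := by
    ext i j
    rw [Matrix.add_apply]
    rcases lt_trichotomy i j with h | rfl | h
    · simp [hermOf_of_lt _ h]
    · simp [hermOf_diag, add_smul]
    · simp [hermOf_of_gt _ h]
  map_smul' r p := by
    ext i j
    rw [Matrix.smul_apply]
    rcases lt_trichotomy i j with h | rfl | h
    · simp [hermOf_of_lt _ h]
    · simp [hermOf_diag, smul_smul]
    · simp [hermOf_of_gt _ h]

variable (F n) in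
/-- The coordinates of a (Hermitian) matrix. -/
def coordLin : Matrix (Fin n) (Fin n) F →ₗ[ℝ] HermCoord F n where
  toFun A := (fun i => inner ℝ (1 : F) (A i i), fun q => A q.1.1 q.1.2)
  map_add' A B := by ext <;> simp [inner_add_right]
  map_smul' r A := by ext <;> simp [inner_smul_right]

theorem coordLin_hermOf (p : HermCoord F n) : coordLin F n (hermOf p) = p := by
  refine Prod.ext (funext fun i => ?_) (funext fun q => ?_)
  · change inner ℝ (1 : F) (hermOf p i i) = _
    rw [hermOf_diag, inner_smul_right, inner_one_one, mul_one]
  · exact hermOf_of_lt p q.2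

theorem hermOf_coordLin {A : Matrix (Fin n) (Fin n) F} (hA : A.IsHermitian) :
    hermOf (coordLin F n A) = A := by
  ext i j
  rcases lt_trichotomy i j with h | rfl | h
  · rw [hermOf_of_lt _ h]; rfl
  · rw [hermOf_diag]; exact (hA.diag_eq i).symm
  · rw [hermOf_of_gt _ h]; exact hA.apply i j

/-- The congruence `V ↦ B V Bᴴ` in Hermitian coordinates. -/
def congrLin (B : Matrix (Fin n) (Fin n) F) : HermCoord F n →ₗ[ℝ] HermCoord F n where
  toFun p := coordLin F n (B * hermLin F n p * Bᴴ)
  map_add' p q := by simp [mul_add, add_mul]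
  map_smul' r p := by simp

theorem hermOf_congrLin (B : Matrix (Fin n) (Fin n) F) (p : HermCoord F n) :
    hermOf (congrLin B p) = B * hermOf p * Bᴴ :=
  hermOf_coordLin (Matrix.isHermitian_mul_mul_conjTranspose B (hermOf_isHermitian p))

theorem hermOf_injective : Function.Injective (hermOf : HermCoord F n → _) :=
  Function.LeftInverse.injective coordLin_hermOf

theorem congrLin_one : congrLin (1 : Matrix (Fin n) (Fin n) F) = LinearMap.id := by
  refine LinearMap.ext fun p => hermOf_injective ?_
  rw [hermOf_congrLin]; simp

theorem congrLin_mul (A B : Matrix (Fin n) (Fin n) F) :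
    congrLin (A * B) = congrLin A ∘ₗ congrLin B := by
  refine LinearMap.ext fun p => hermOf_injective ?_
  rw [hermOf_congrLin, LinearMap.comp_apply, hermOf_congrLin, hermOf_congrLin,
    Matrix.conjTranspose_mul]
  simp only [Matrix.mul_assoc]

variable (F n) in
/-- The absolute Jacobian of a congruence on Hermitian matrices. -/
def congrJac : (Matrix (Fin n) (Fin n) F)ˣ →* ℝ where
  toFun u := |LinearMap.det (congrLin (u : Matrix (Fin n) (Fin n) F))|
  map_one' := by simp [congrLin_one]
  map_mul' u v := by rw [Units.val_mul, congrLin_mul, LinearMap.det_comp, abs_mul]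

variable (F n) in
/-- The character `u ↦ |u| ^ s`. -/
def detFPow (s : ℝ) : (Matrix (Fin n) (Fin n) F)ˣ →* ℝ where
  toFun u := detF (u : Matrix (Fin n) (Fin n) F) ^ s
  map_one' := by simp [detF_one]
  map_mul' u v := by rw [Units.val_mul, detF_mul, Real.mul_rpow (detF_nonneg _) (detF_nonneg _)]

/-- Pairs (i, j) split into i < j, i = j and i > j; taking the factor `d i` from each pair gives the
right side. Keeping the diagonal product on the left avoids the truncated exponent n - 1. -/
theorem prod_lt_mul (d : Fin n → ℝ) :
    (∏ q : {q : Fin n × Fin n // q.1 < q.2}, d q.1.1 * d q.1.2) * ∏ i, d i = (∏ i, d i) ^ n := by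
  have h1 : (∏ i, d i) ^ n = ∏ p : Fin n × Fin n, d p.1 := by
    rw [Fintype.prod_prod_type]; simp [Finset.prod_pow]
  have h2 : ∏ i, d i = ∏ p : Fin n × Fin n, if p.1 = p.2 then d p.1 else 1 := by
    rw [Fintype.prod_prod_type]; simp
  have h3 : ∏ q : {q : Fin n × Fin n // q.1 < q.2}, d q.1.1
      = ∏ p : Fin n × Fin n, if p.1 < p.2 then d p.1 else 1 := by
    rw [← Finset.prod_filter]
    exact (Finset.prod_subtype _ (by simp) (fun p : Fin n × Fin n => d p.1)).symm
  have h4 : ∏ q : {q : Fin n × Fin n // q.1 < q.2}, d q.1.2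
      = ∏ p : Fin n × Fin n, if p.2 < p.1 then d p.1 else 1 := by
    rw [Fintype.prod_prod_type, Finset.prod_comm, ← Fintype.prod_prod_type
      (fun p : Fin n × Fin n => if p.1 < p.2 then d p.2 else 1), ← Finset.prod_filter]
    exact (Finset.prod_subtype _ (by simp) (fun p : Fin n × Fin n => d p.2)).symm
  rw [h1, Finset.prod_mul_distrib, h3, h4, h2, ← Finset.prod_mul_distrib,
    ← Finset.prod_mul_distrib]
  refine Finset.prod_congr rfl fun p _ => ?_
  rcases lt_trichotomy p.1 p.2 with h | h | h
  · simp [h, h.ne, h.not_gt]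
  · simp [h]
  · simp [h, h.ne', h.not_gt]

variable [FiniteDimensional ℝ F]

theorem detF_diagUnit (d : Fin n → ℝ) (hd : ∀ i, 0 < d i) :
    detF (diagUnit d fun i => (hd i).ne' : (Matrix (Fin n) (Fin n) F)ˣ).val = ∏ i, d i := by
  have h : realLin (diagUnit d fun i => (hd i).ne' : (Matrix (Fin n) (Fin n) F)ˣ).val
      = LinearMap.pi fun i => (d i • (LinearMap.id : F →ₗ[ℝ] F)) ∘ₗ LinearMap.proj i := by
    refine LinearMap.ext fun x => funext fun i => ?_
    change ((Matrix.diagonal fun i => d i • (1 : F)) *ᵥ x) i = d i • x i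
    rw [Matrix.mulVec_diagonal]
    simp
  rw [detF, h, LinearMap.det_pi]
  simp only [LinearMap.det_smul, LinearMap.det_id, mul_one, Finset.prod_pow]
  have hp : 0 ≤ ∏ i, d i := Finset.prod_nonneg fun i _ => (hd i).le
  rw [abs_of_nonneg (pow_nonneg hp _), ← Real.rpow_natCast, ← Real.rpow_mul hp, rdim,
    mul_one_div_cancel, Real.rpow_one]
  exact (rdim_pos F).ne'

/-- A diagonal congruence scales the coordinate at (i, j) by `d i * d j`. The real diagonal
contributes |D|², and the β-dimensional entries above it contribute |D|^(β(n-1)). -/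
theorem congrJac_diagUnit (d : Fin n → ℝ) (hd : ∀ i, 0 < d i) :
    congrJac F n (diagUnit d fun i => (hd i).ne')
      = detFPow F n (rdim F * ((n : ℝ) - 1) + 2) (diagUnit d fun i => (hd i).ne') := by
  have h : congrLin (diagUnit d fun i => (hd i).ne' : (Matrix (Fin n) (Fin n) F)ˣ).val
      = LinearMap.prodMap
        (LinearMap.pi fun i => ((d i) ^ 2 • (LinearMap.id : ℝ →ₗ[ℝ] ℝ)) ∘ₗ LinearMap.proj i)
        (LinearMap.pi fun q => ((d q.1.1 * d q.1.2) • (LinearMap.id : F →ₗ[ℝ] F)) ∘ₗ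
          LinearMap.proj q) := by
    refine LinearMap.ext fun p => ?_
    have hc : ∀ i j, ((diagUnit d fun i => (hd i).ne' : (Matrix (Fin n) (Fin n) F)ˣ).val *
        hermOf p * (diagUnit d fun i => (hd i).ne' : (Matrix (Fin n) (Fin n) F)ˣ).valᴴ) i j
        = (d i * d j) • hermOf p i j := by
      intro i j
      simp only [diagUnit, Matrix.diagonal_conjTranspose, Matrix.mul_diagonal,
        Matrix.diagonal_mul]
      simp [smul_smul, mul_comm]
    refine Prod.ext (funext fun i => ?_) (funext fun q => ?_)
    · refine (congrArg (inner ℝ (1 : F)) (hc i i)).trans ?_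
      rw [hermOf_diag, inner_smul_right, inner_smul_right, inner_one_one]
      simp [sq]
    · refine (hc _ _).trans ?_
      rw [hermOf_of_lt p q.2]
      simp
  have hp : 0 < ∏ i, d i := Finset.prod_pos fun i _ => hd i
  have hq := prod_lt_mul d
  change |LinearMap.det (congrLin (diagUnit d fun i => (hd i).ne' :
    (Matrix (Fin n) (Fin n) F)ˣ).val)| = detF (diagUnit d fun i => (hd i).ne' :
    (Matrix (Fin n) (Fin n) F)ˣ).val ^ (rdim F * ((n : ℝ) - 1) + 2)
  rw [h, detF_diagUnit d hd, LinearMap.det_prodMap, LinearMap.det_pi, LinearMap.det_pi]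
  simp only [LinearMap.det_smul, LinearMap.det_id, mul_one, Finset.prod_pow, Module.finrank_self,
    pow_one]
  have hq' : ∏ q : {q : Fin n × Fin n // q.1 < q.2}, d q.1.1 * d q.1.2
      = (∏ i, d i) ^ ((n : ℝ) - 1) := by
    rw [Real.rpow_sub hp, Real.rpow_one, Real.rpow_natCast, eq_div_iff hp.ne']
    exact hq
  rw [hq', ← Real.rpow_natCast _ (Module.finrank ℝ F), ← Real.rpow_mul hp.le, abs_of_pos (by positivity),
    Real.rpow_add hp, mul_comm]
  congr 1
  · rw [mul_comm]; rfl
  · exact (Real.rpow_natCast _ 2).symm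

/-- The Jacobian formula is needed only for one factor `u` of each `A`, and elimination supplies a
factor on which the two characters agree. -/
theorem IsPosDef.exists_unit_congrJac {A : Matrix (Fin n) (Fin n) F} (hA : IsPosDef A) :
    ∃ u : (Matrix (Fin n) (Fin n) F)ˣ,
      |LinearMap.det (congrLin (u : Matrix (Fin n) (Fin n) F))|
        = detF (u : Matrix (Fin n) (Fin n) F) ^ (rdim F * ((n : ℝ) - 1) + 2) ∧
      A = (u : Matrix (Fin n) (Fin n) F)ᴴ * u :=
  hA.exists_eq_conjTranspose_mul_self (congrJac F n) (detFPow F n _) congrJac_diagUnit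

end HermitianCoordinates

/-! ### Jacobians of left and right multiplication -/

section MatrixJacobians

variable {F : Type*} [NormedDivisionRing F] [StarRing F] [InnerProductSpace ℝ F]
  [RealNormedDivisionAlgebra F] {m n : ℕ}

/-- Conjugate transposition as a real linear equivalence. -/
def conjTransposeLin (F : Type*) [NormedDivisionRing F] [StarRing F] [InnerProductSpace ℝ F]
    [RealNormedDivisionAlgebra F] (m n : ℕ) :
    Matrix (Fin m) (Fin n) F ≃ₗ[ℝ] Matrix (Fin n) (Fin m) F where
  toFun X := Xᴴ
  invFun X := Xᴴ
  map_add' X Y := Matrix.conjTranspose_add X Y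
  map_smul' r X := by rw [Matrix.conjTranspose_smul]; rfl
  left_inv X := Matrix.conjTranspose_conjTranspose X
  right_inv X := Matrix.conjTranspose_conjTranspose X

/-- Entrywise conjugation of vectors as a real linear equivalence. -/
def starLin (F : Type*) [NormedDivisionRing F] [StarRing F] [InnerProductSpace ℝ F]
    [RealNormedDivisionAlgebra F] (n : ℕ) :
    (Fin n → F) ≃ₗ[ℝ] (Fin n → F) where
  toFun x := star x
  invFun x := star x
  map_add' x y := star_add x y
  map_smul' r x := by funext i; simp
  left_inv x := star_star x
  right_inv x := star_star x

/-- The real linear map `X ↦ X L`. -/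
def rightMulLin (m : ℕ) (L : Matrix (Fin n) (Fin n) F) :
    Matrix (Fin m) (Fin n) F →ₗ[ℝ] Matrix (Fin m) (Fin n) F where
  toFun X := X * L
  map_add' X Y := Matrix.add_mul X Y L
  map_smul' r X := Matrix.smul_mul r X L

/-- The real linear map `X ↦ B X`. -/
def leftMulLin (n : ℕ) (B : Matrix (Fin m) (Fin m) F) :
    Matrix (Fin m) (Fin n) F →ₗ[ℝ] Matrix (Fin m) (Fin n) F where
  toFun X := B * X
  map_add' X Y := Matrix.mul_add B X Y
  map_smul' r X := Matrix.mul_smul B r X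

variable [FiniteDimensional ℝ F]

/-- The m rows transform independently. On one row, x ↦ xL is conjugate under entrywise `star` to
the left action of `Lᴴ`, so noncommutativity costs nothing and each row contributes |L|^β. -/
theorem abs_det_rightMulLin (m : ℕ) (L : Matrix (Fin n) (Fin n) F) :
    |LinearMap.det (rightMulLin m L)| = detF L ^ (rdim F * m) := by
  have h : LinearMap.det (rightMulLin m L) = LinearMap.det (LinearMap.pi fun i : Fin m =>
      ((starLin F n : (Fin n → F) →ₗ[ℝ] (Fin n → F)) ∘ₗ realLin Lᴴ ∘ₗ
        ((starLin F n).symm : (Fin n → F) →ₗ[ℝ] (Fin n → F))) ∘ₗ LinearMap.proj i) := by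
    change LinearMap.det (M := Fin m → Fin n → F) (rightMulLin m L) = _
    congr 1
    refine LinearMap.ext fun X => funext fun i => ?_
    change X i ᵥ* L = star (Lᴴ *ᵥ star (X i))
    rw [Matrix.star_mulVec, star_star, Matrix.conjTranspose_conjTranspose]
  rw [h, LinearMap.det_pi]
  simp only [LinearMap.det_conj, Finset.prod_const, Finset.card_univ, Fintype.card_fin]
  rw [abs_pow, ← detF_rpow_rdim, detF_conjTranspose, ← Real.rpow_natCast,
    ← Real.rpow_mul (detF_nonneg _)]

theorem abs_det_leftMulLin (n : ℕ) (B : Matrix (Fin m) (Fin m) F) :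
    |LinearMap.det (leftMulLin n B)| = detF B ^ (rdim F * n) := by
  have h : leftMulLin n B = (conjTransposeLin F n m : _ →ₗ[ℝ] Matrix (Fin m) (Fin n) F) ∘ₗ
      rightMulLin n Bᴴ ∘ₗ ((conjTransposeLin F n m).symm : _ →ₗ[ℝ] Matrix (Fin n) (Fin m) F) := by
    refine LinearMap.ext fun X => ?_
    change B * X = (Xᴴ * Bᴴ)ᴴ
    simp
  rw [h, LinearMap.det_conj, abs_det_rightMulLin, detF_conjTranspose]

end MatrixJacobians

/-! ### Continuity and openness of the cone -/

section Continuity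

variable {F : Type*} [NormedDivisionRing F] [StarRing F] [InnerProductSpace ℝ F]
  [RealNormedDivisionAlgebra F] {m n : ℕ}

theorem continuous_star_div : Continuous (star : F → F) := by
  have h : (star : F → F) = fun a => (2 * inner ℝ (1 : F) a) • (1 : F) - a := funext star_eq
  rw [h]
  fun_prop

instance : ContinuousStar F := ⟨continuous_star_div⟩

theorem continuous_retr : Continuous (retr : Matrix (Fin n) (Fin n) F → ℝ) :=
  continuous_const.inner (Continuous.matrix_trace continuous_id)

variable [FiniteDimensional ℝ F]

theorem continuous_detF : Continuous (detF : Matrix (Fin n) (Fin n) F → ℝ) := by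
  classical
  let b := Module.finBasis ℝ (Fin n → F)
  have h : Continuous fun A : Matrix (Fin n) (Fin n) F => LinearMap.det (realLin A) := by
    simp_rw [← LinearMap.det_toMatrix b]
    refine Continuous.matrix_det (continuous_matrix fun i j => ?_)
    simp_rw [LinearMap.toMatrix_apply]
    exact (LinearMap.continuous_of_finiteDimensional (b.coord i)).comp
      (Continuous.matrix_mulVec continuous_id continuous_const)
  exact h.abs.rpow_const fun _ => Or.inr (by have := rdim_pos F; positivity)

theorem continuous_hermOf : Continuous (hermOf : HermCoord F n → Matrix (Fin n) (Fin n) F) :=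
  LinearMap.continuous_of_finiteDimensional (hermLin F n)

/-- The condition is open in `A` for each `x`, and compactness of the unit sphere makes it uniform.
Hermitian symmetry is left out because it is a closed condition in the full matrix space. -/
theorem isOpen_quadForm_pos :
    IsOpen {A : Matrix (Fin n) (Fin n) F |
      ∀ x ∈ Metric.sphere (0 : Fin n → F) 1, 0 < inner ℝ (1 : F) (star x ⬝ᵥ (A *ᵥ x))} := by
  rw [isOpen_iff_eventually]
  intro A hA
  refine (isCompact_sphere (0 : Fin n → F) 1).eventually_forall_of_forall_eventually fun x hx => ?_
  have hc : Continuous fun z : Matrix (Fin n) (Fin n) F × (Fin n → F) =>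
      inner ℝ (1 : F) (star z.2 ⬝ᵥ (z.1 *ᵥ z.2)) :=
    continuous_const.inner ((continuous_star.comp continuous_snd).dotProduct
      (continuous_fst.matrix_mulVec continuous_snd))
  exact hc.continuousAt.eventually_const_lt (hA x hx)

theorem isPosDef_iff_sphere (A : Matrix (Fin n) (Fin n) F) :
    IsPosDef A ↔ A.IsHermitian ∧
      ∀ x ∈ Metric.sphere (0 : Fin n → F) 1, 0 < inner ℝ (1 : F) (star x ⬝ᵥ (A *ᵥ x)) := by
  refine and_congr_right fun _ => ⟨fun h x hx => h x ?_, fun h x hx => ?_⟩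
  · rintro rfl
    simp at hx
  · have hn : 0 < ‖x‖ := norm_pos_iff.2 hx
    have h1 := h (‖x‖⁻¹ • x) (by simp [norm_smul, hn.ne'])
    rw [star_smul, star_trivial, Matrix.mulVec_smul, smul_dotProduct, dotProduct_smul,
      inner_smul_right, inner_smul_right] at h1
    exact pos_of_mul_pos_right (pos_of_mul_pos_right h1 (by positivity)) (by positivity)

theorem isOpen_isPosDef_hermOf : IsOpen {p : HermCoord F n | IsPosDef (hermOf p)} := by
  have h : {p : HermCoord F n | IsPosDef (hermOf p)} = hermOf ⁻¹' {A : Matrix (Fin n) (Fin n) F |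
      ∀ x ∈ Metric.sphere (0 : Fin n → F) 1, 0 < inner ℝ (1 : F) (star x ⬝ᵥ (A *ᵥ x))} := by
    ext p
    exact (isPosDef_iff_sphere _).trans (and_iff_right (hermOf_isHermitian p))
  rw [h]
  exact isOpen_quadForm_pos.preimage continuous_hermOf

end Continuity

/-! ### Changes of variables and the Gaussian integral -/

section Integration

variable {F : Type*} [NormedDivisionRing F] [StarRing F] [InnerProductSpace ℝ F]
  [RealNormedDivisionAlgebra F] [FiniteDimensional ℝ F] [MeasurableSpace F] [BorelSpace F]
  {m n : ℕ}

instance : ProperSpace F := FiniteDimensional.proper_real F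

instance : BorelSpace (Matrix (Fin m) (Fin n) F) :=
  inferInstanceAs (BorelSpace (Fin m → Fin n → F))

instance : SecondCountableTopology (Matrix (Fin m) (Fin n) F) :=
  inferInstanceAs (SecondCountableTopology (Fin m → Fin n → F))

instance {ι : Type*} [Fintype ι] :
    (Measure.pi fun _ : ι => (volume : Measure F)).IsAddHaarMeasure :=
  Measure.pi.isAddHaarMeasure _

instance : (volume : Measure (Fin m → Fin n → F)).IsAddHaarMeasure :=
  Measure.pi.isAddHaarMeasure fun _ : Fin m => Measure.pi fun _ : Fin n => (volume : Measure F)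

instance : (volume : Measure (HermCoord F n)).IsAddHaarMeasure :=
  Measure.prod.instIsAddHaarMeasure (Measure.pi fun _ : Fin n => (volume : Measure ℝ))
    (Measure.pi fun _ : {q : Fin n × Fin n // q.1 < q.2} => (volume : Measure F))

instance : SFinite (matVolume F m n) :=
  inferInstanceAs (SFinite (volume : Measure (Fin m → Fin n → F)))

theorem hermVolume_eq_map : hermVolume F n = (volume : Measure (HermCoord F n)).map hermOf := rfl

instance : SFinite (hermVolume F n) :=
  inferInstanceAs (SFinite ((volume : Measure (HermCoord F n)).map hermOf))

theorem measurableSet_isPosDef : MeasurableSet {A : Matrix (Fin n) (Fin n) F | IsPosDef A} := by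
  simp_rw [isPosDef_iff_sphere]
  have h1 : IsClosed {A : Matrix (Fin n) (Fin n) F | A.IsHermitian} :=
    isClosed_eq (Continuous.matrix_conjTranspose continuous_id) continuous_id
  exact h1.measurableSet.inter isOpen_quadForm_pos.measurableSet

theorem measurable_detF : Measurable (detF : Matrix (Fin n) (Fin n) F → ℝ) :=
  continuous_detF.measurable

theorem measurable_retr : Measurable (retr : Matrix (Fin n) (Fin n) F → ℝ) :=
  continuous_retr.measurable

theorem measurable_hermOf : Measurable (hermOf : HermCoord F n → Matrix (Fin n) (Fin n) F) :=
  continuous_hermOf.measurable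

theorem lintegral_hermVolume_congr (u : (Matrix (Fin n) (Fin n) F)ˣ)
    {f : Matrix (Fin n) (Fin n) F → ENNReal} (hf : Measurable f) :
    ENNReal.ofReal |LinearMap.det (congrLin (u : Matrix (Fin n) (Fin n) F))| *
        ∫⁻ V, f ((u : Matrix (Fin n) (Fin n) F) * V * (u : Matrix (Fin n) (Fin n) F)ᴴ)
          ∂hermVolume F n
      = ∫⁻ V, f V ∂hermVolume F n := by
  have hdet : LinearMap.det (congrLin (u : Matrix (Fin n) (Fin n) F)) ≠ 0 := by
    have h := ((Group.isUnit u).map (congrJac F n)).ne_zero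
    exact abs_ne_zero.1 h
  have hm : Measurable fun V : Matrix (Fin n) (Fin n) F =>
      f ((u : Matrix (Fin n) (Fin n) F) * V * (u : Matrix (Fin n) (Fin n) F)ᴴ) :=
    hf.comp (Continuous.measurable (by fun_prop))
  rw [hermVolume_eq_map, lintegral_map hm measurable_hermOf, lintegral_map hf measurable_hermOf]
  simp_rw [← hermOf_congrLin]
  have hl : Measurable (congrLin (u : Matrix (Fin n) (Fin n) F)) :=
    (LinearMap.continuous_of_finiteDimensional _).measurable
  have h := lintegral_map (μ := (volume : Measure (HermCoord F n))) (hf.comp measurable_hermOf) hl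
  rw [Measure.map_linearMap_addHaar_eq_smul_addHaar _ hdet, lintegral_smul_measure] at h
  simp only [Function.comp_apply] at h
  rw [← h, smul_eq_mul, ← mul_assoc, abs_inv, ← ENNReal.ofReal_mul (abs_nonneg _),
    mul_inv_cancel₀ (abs_ne_zero.2 hdet), ENNReal.ofReal_one, one_mul]

theorem lintegral_matVolume_linearMap
    (g : Matrix (Fin m) (Fin n) F →ₗ[ℝ] Matrix (Fin m) (Fin n) F) (hg : LinearMap.det g ≠ 0)
    {f : Matrix (Fin m) (Fin n) F → ENNReal} (hf : Measurable f) :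
    ENNReal.ofReal |LinearMap.det g| * ∫⁻ X, f (g X) ∂matVolume F m n
      = ∫⁻ X, f X ∂matVolume F m n := by
  have key : ∀ (g : (Fin m → Fin n → F) →ₗ[ℝ] (Fin m → Fin n → F)), LinearMap.det g ≠ 0 →
      ∀ {f : (Fin m → Fin n → F) → ENNReal}, Measurable f →
      ENNReal.ofReal |LinearMap.det g| * ∫⁻ X, f (g X) = ∫⁻ X, f X := by
    intro g hg f hf
    have hl : Measurable g := (LinearMap.continuous_of_finiteDimensional g).measurable
    have h := lintegral_map (μ := (volume : Measure (Fin m → Fin n → F))) hf hl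
    rw [Measure.map_linearMap_addHaar_eq_smul_addHaar _ hg, lintegral_smul_measure] at h
    rw [← h, smul_eq_mul, ← mul_assoc, abs_inv, ← ENNReal.ofReal_mul (abs_nonneg _),
      mul_inv_cancel₀ (abs_ne_zero.2 hg), ENNReal.ofReal_one, one_mul]
  exact key g hg hf

theorem lintegral_matVolume_mul_right {L : Matrix (Fin n) (Fin n) F} (hL : IsUnit L)
    {f : Matrix (Fin m) (Fin n) F → ENNReal} (hf : Measurable f) :
    ENNReal.ofReal (detF L ^ (rdim F * m)) * ∫⁻ X, f (X * L) ∂matVolume F m n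
      = ∫⁻ X, f X ∂matVolume F m n := by
  have h := abs_det_rightMulLin m L
  have hd : LinearMap.det (rightMulLin m L) ≠ 0 := by
    rw [← abs_ne_zero, h]
    exact (Real.rpow_pos_of_pos (detF_pos_of_isUnit hL) _).ne'
  rw [← h]
  exact lintegral_matVolume_linearMap _ hd hf

theorem lintegral_matVolume_mul_left {B : Matrix (Fin m) (Fin m) F} (hB : IsUnit B)
    {f : Matrix (Fin m) (Fin n) F → ENNReal} (hf : Measurable f) :
    ENNReal.ofReal (detF B ^ (rdim F * n)) * ∫⁻ X, f (B * X) ∂matVolume F m n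
      = ∫⁻ X, f X ∂matVolume F m n := by
  have h := abs_det_leftMulLin n B
  have hd : LinearMap.det (leftMulLin n B) ≠ 0 := by
    rw [← abs_ne_zero, h]
    exact (Real.rpow_pos_of_pos (detF_pos_of_isUnit hB) _).ne'
  rw [← h]
  exact lintegral_matVolume_linearMap _ hd hf

theorem lintegral_matVolume_sub (M : Matrix (Fin m) (Fin n) F)
    (f : Matrix (Fin m) (Fin n) F → ENNReal) :
    ∫⁻ X, f (X - M) ∂matVolume F m n = ∫⁻ X, f X ∂matVolume F m n :=
  lintegral_sub_right_eq_self (μ := (volume : Measure (Fin m → Fin n → F))) f M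

theorem lintegral_exp_neg_retr_mul_conjTranspose :
    ∫⁻ X : Matrix (Fin m) (Fin n) F, ENNReal.ofReal (Real.exp (-retr (X * Xᴴ))) ∂matVolume F m n
      = ENNReal.ofReal (Real.pi ^ (m * n * rdim F / 2)) := by
  have h1 : ∫ z : F, Real.exp (-‖z‖ ^ 2) = Real.pi ^ (rdim F / 2) := by
    have h := GaussianFourier.integral_rexp_neg_mul_sq_norm (V := F) one_pos
    simp only [neg_mul, one_mul, div_one] at h
    exact h
  have h2 : ∀ X : Matrix (Fin m) (Fin n) F, Real.exp (-retr (X * Xᴴ))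
      = ∏ i, ∏ j, Real.exp (-‖X i j‖ ^ 2) := by
    intro X
    rw [retr_mul_conjTranspose_self, ← Finset.sum_neg_distrib, Real.exp_sum]
    refine Finset.prod_congr rfl fun i _ => ?_
    rw [← Finset.sum_neg_distrib, Real.exp_sum]
  have h3 : ∫ X : Matrix (Fin m) (Fin n) F, Real.exp (-retr (X * Xᴴ)) ∂matVolume F m n
      = Real.pi ^ (m * n * rdim F / 2) := by
    simp_rw [h2]
    have e1 := integral_fintype_prod_eq_prod (𝕜 := ℝ)
      (μ := fun _ : Fin m => Measure.pi fun _ : Fin n => (volume : Measure F))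
      (fun (_ : Fin m) (x : Fin n → F) => ∏ j, Real.exp (-‖x j‖ ^ 2))
    have e2 := integral_fintype_prod_eq_prod (𝕜 := ℝ)
      (μ := fun _ : Fin n => (volume : Measure F))
      (fun (_ : Fin n) (x : F) => Real.exp (-‖x‖ ^ 2))
    refine e1.trans ?_
    simp only [e2, h1, Finset.prod_const, Finset.card_univ, Fintype.card_fin]
    rw [← pow_mul, ← Real.rpow_natCast, ← Real.rpow_mul Real.pi_pos.le]
    congr 1
    push_cast
    ring
  rw [← ofReal_integral_eq_lintegral_ofReal, h3]
  -- Integrability comes for free: the Bochner integral of a non-integrable function is 0, whereas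
  -- this one is positive.
  · by_contra hi
    rw [integral_undef hi] at h3
    have : 0 < Real.pi ^ (m * n * rdim F / 2) := by positivity
    exact this.ne h3
  · exact Filter.Eventually.of_forall fun _ => (Real.exp_pos _).le

end Integration

/-! ### Gamma integrals in the extended nonnegative reals -/

section GammaIntegrals

variable {F : Type*} [NormedDivisionRing F] [StarRing F] [InnerProductSpace ℝ F]
  [RealNormedDivisionAlgebra F] [FiniteDimensional ℝ F] [MeasurableSpace F] [BorelSpace F]
  {m n : ℕ}

variable (F) in
/-- The multivariate Gamma integral as an extended nonnegative number. -/
def lgamma (n : ℕ) (a : ℝ) : ENNReal :=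
  ∫⁻ A in {A : Matrix (Fin n) (Fin n) F | IsPosDef A}, ENNReal.ofReal
    (Real.exp (-retr A) * detF A ^ (a - ((n : ℝ) - 1) * rdim F / 2 - 1)) ∂(hermVolume F n)

theorem isPosDef_congr_iff (u : (Matrix (Fin n) (Fin n) F)ˣ) (V : Matrix (Fin n) (Fin n) F) :
    IsPosDef ((u : Matrix (Fin n) (Fin n) F) * V * (u : Matrix (Fin n) (Fin n) F)ᴴ) ↔
      IsPosDef V := by
  constructor
  · intro h
    have h1 := h.conj (star u⁻¹)
    have h2 : (↑(star u⁻¹) : Matrix (Fin n) (Fin n) F) = (↑u⁻¹ : Matrix (Fin n) (Fin n) F)ᴴ := rfl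
    rw [h2, Matrix.conjTranspose_conjTranspose] at h1
    have h3 : (u : Matrix (Fin n) (Fin n) F)ᴴ * (↑u⁻¹ : Matrix (Fin n) (Fin n) F)ᴴ = 1 := by
      rw [← Matrix.conjTranspose_mul, Units.inv_mul, Matrix.conjTranspose_one]
    rwa [Matrix.mul_assoc, Matrix.mul_assoc, h3, Matrix.mul_one, ← Matrix.mul_assoc,
      Units.inv_mul, Matrix.one_mul] at h1
  · intro h
    have h1 := h.conj (star u)
    have h2 : (↑(star u) : Matrix (Fin n) (Fin n) F) = (u : Matrix (Fin n) (Fin n) F)ᴴ := rfl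
    rwa [h2, Matrix.conjTranspose_conjTranspose] at h1

theorem detF_conjTranspose_mul_self_rpow (u : Matrix (Fin n) (Fin n) F) (s : ℝ) :
    detF (uᴴ * u) ^ (s / 2) = detF u ^ s := by
  rw [detF_mul, detF_conjTranspose, ← sq, ← Real.rpow_natCast, ← Real.rpow_mul (detF_nonneg u)]
  congr 1
  push_cast
  ring

/-- Write A = uᴴu and substitute uVuᴴ for the variable. The Jacobian |u|^(β(n-1)+2) =
|A|^((n-1)β/2+1) exactly undoes the shift in the exponent, leaving |A|^a. No condition on `a` is
needed because both sides may be infinite. -/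
theorem lintegral_exp_retr_mul {A : Matrix (Fin n) (Fin n) F} (hA : IsPosDef A) (a : ℝ) :
    ENNReal.ofReal (detF A ^ a) * ∫⁻ V in {V : Matrix (Fin n) (Fin n) F | IsPosDef V},
        ENNReal.ofReal (Real.exp (-retr (A * V)) *
          detF V ^ (a - ((n : ℝ) - 1) * rdim F / 2 - 1)) ∂(hermVolume F n)
      = lgamma F n a := by
  obtain ⟨u, hJ, hu⟩ := hA.exists_unit_congrJac
  set e : ℝ := a - ((n : ℝ) - 1) * rdim F / 2 - 1 with he
  have hmeas : ∀ B : Matrix (Fin n) (Fin n) F, Measurable fun V : Matrix (Fin n) (Fin n) F =>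
      ENNReal.ofReal (Real.exp (-retr (B * V)) * detF V ^ e) := fun B =>
    (((measurable_retr.comp (Continuous.measurable (by fun_prop))).neg.exp).mul
      (measurable_detF.pow_const _)).ennreal_ofReal
  have hm1 := hmeas 1
  simp only [one_mul] at hm1
  have key := lintegral_hermVolume_congr u (hm1.indicator measurableSet_isPosDef)
  rw [lintegral_indicator measurableSet_isPosDef] at key
  change _ = lgamma F n a at key
  rw [← key, ← lintegral_indicator measurableSet_isPosDef, hJ]
  have hpt : ∀ V : Matrix (Fin n) (Fin n) F, ({V | IsPosDef V}.indicator (fun V =>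
        ENNReal.ofReal (Real.exp (-retr V) * detF V ^ e)))
        ((u : Matrix (Fin n) (Fin n) F) * V * (u : Matrix (Fin n) (Fin n) F)ᴴ)
      = ENNReal.ofReal (detF A ^ e) * {V | IsPosDef V}.indicator (fun V =>
        ENNReal.ofReal (Real.exp (-retr (A * V)) * detF V ^ e)) V := by
    intro V
    by_cases hV : IsPosDef V
    · rw [Set.indicator_of_mem (by exact (isPosDef_congr_iff u V).2 hV),
        Set.indicator_of_mem (by exact hV),
        ← ENNReal.ofReal_mul (Real.rpow_nonneg (detF_nonneg A) e)]
      have h1 : retr ((u : Matrix (Fin n) (Fin n) F) * V * (u : Matrix (Fin n) (Fin n) F)ᴴ)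
          = retr (A * V) := by
        rw [retr_mul_comm, hu, ← Matrix.mul_assoc]
      have h2 : detF ((u : Matrix (Fin n) (Fin n) F) * V * (u : Matrix (Fin n) (Fin n) F)ᴴ)
          = detF A * detF V := by
        rw [hu, detF_mul, detF_mul, detF_mul, detF_conjTranspose]; ring
      rw [h1, h2, Real.mul_rpow (detF_nonneg _) (detF_nonneg _)]
      congr 1; ring
    · rw [Set.indicator_of_notMem (by exact fun h => hV ((isPosDef_congr_iff u V).1 h)),
        Set.indicator_of_notMem (by exact hV), mul_zero]
  simp_rw [hpt]
  rw [lintegral_const_mul _ ((hmeas A).indicator measurableSet_isPosDef), ← mul_assoc,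
    ← ENNReal.ofReal_mul (Real.rpow_nonneg (detF_nonneg _) _)]
  congr 2
  rw [← detF_conjTranspose_mul_self_rpow (u : Matrix (Fin n) (Fin n) F), ← hu,
    ← Real.rpow_add hA.detF_pos, he]
  congr 1
  ring

/-- With V = uᴴu and N = wᴴw, the substitution X = uTwᴴ reduces to the standard Gaussian. -/
theorem lintegral_gaussian {V : Matrix (Fin m) (Fin m) F} (hV : IsPosDef V)
    {N : Matrix (Fin n) (Fin n) F} (hN : IsPosDef N) :
    ENNReal.ofReal (detF V ^ (rdim F * n / 2) * detF N ^ (rdim F * m / 2)) *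
        ∫⁻ T, ENNReal.ofReal (Real.exp (-retr (T * N * Tᴴ * V))) ∂matVolume F m n
      = ENNReal.ofReal (Real.pi ^ (m * n * rdim F / 2)) := by
  obtain ⟨u, hu⟩ := hV.exists_unit
  obtain ⟨w, hw⟩ := hN.exists_unit
  have hret : ∀ T : Matrix (Fin m) (Fin n) F, retr (T * N * Tᴴ * V)
      = retr ((u : Matrix (Fin m) (Fin m) F) * (T * (w : Matrix (Fin n) (Fin n) F)ᴴ) *
        ((u : Matrix (Fin m) (Fin m) F) * (T * (w : Matrix (Fin n) (Fin n) F)ᴴ))ᴴ) := by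
    intro T
    rw [hu, hw]
    simp only [Matrix.conjTranspose_mul, Matrix.conjTranspose_conjTranspose]
    conv_rhs => rw [Matrix.mul_assoc, retr_mul_comm]
    simp only [Matrix.mul_assoc]
  have hm : Measurable fun X : Matrix (Fin m) (Fin n) F =>
      ENNReal.ofReal (Real.exp (-retr (X * Xᴴ))) :=
    ((measurable_retr.comp (Continuous.measurable (by fun_prop))).neg.exp).ennreal_ofReal
  have hm' : Measurable fun X : Matrix (Fin m) (Fin n) F => ENNReal.ofReal (Real.exp
      (-retr ((u : Matrix (Fin m) (Fin m) F) * X * ((u : Matrix (Fin m) (Fin m) F) * X)ᴴ))) :=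
    hm.comp (Continuous.measurable (by fun_prop))
  have h1 := lintegral_matVolume_mul_left (n := n) u.isUnit hm
  have h2 := lintegral_matVolume_mul_right (m := m)
    (L := (w : Matrix (Fin n) (Fin n) F)ᴴ) (IsUnit.star w.isUnit) hm'
  simp_rw [hret]
  rw [← lintegral_exp_neg_retr_mul_conjTranspose, ← h1, ← h2, ← mul_assoc,
    ← ENNReal.ofReal_mul (Real.rpow_nonneg (detF_nonneg _) _), detF_conjTranspose, hu, hw,
    detF_conjTranspose_mul_self_rpow, detF_conjTranspose_mul_self_rpow]

theorem measurable_ofReal_detF_add_conj (M : Matrix (Fin m) (Fin m) F)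
    (N : Matrix (Fin n) (Fin n) F) (s : ℝ) :
    Measurable fun T : Matrix (Fin m) (Fin n) F => ENNReal.ofReal (detF (M + T * N * Tᴴ) ^ s) :=
  ((measurable_detF.comp (Continuous.measurable (by fun_prop))).pow_const s).ennreal_ofReal

/-- Multiplying by `lgamma F m a` turns the power of the determinant into an integral over V. After
Tonelli, the Gaussian integral in T lowers the exponent of |V| by βn/2, which is again a Gamma
integral. This normalizes the T law and, for n = 1, drives the finiteness argument. -/
theorem lgamma_mul_lintegral {M : Matrix (Fin m) (Fin m) F} (hM : IsPosDef M)
    {N : Matrix (Fin n) (Fin n) F} (hN : IsPosDef N) (a : ℝ) :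
    lgamma F m a * ∫⁻ T, ENNReal.ofReal (detF (M + T * N * Tᴴ) ^ (-a)) ∂matVolume F m n
      = ENNReal.ofReal (Real.pi ^ (m * n * rdim F / 2) * detF M ^ (-(a - rdim F * n / 2)) *
          detF N ^ (-(rdim F * m / 2))) * lgamma F m (a - rdim F * n / 2) := by
  set e : ℝ := a - ((m : ℝ) - 1) * rdim F / 2 - 1 with he
  have hret : ∀ (T : Matrix (Fin m) (Fin n) F) (V : Matrix (Fin m) (Fin m) F),
      ENNReal.ofReal (Real.exp (-retr ((M + T * N * Tᴴ) * V)) * detF V ^ e)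
        = ENNReal.ofReal (Real.exp (-retr (M * V)) * detF V ^ e)
          * ENNReal.ofReal (Real.exp (-retr (T * N * Tᴴ * V))) := by
    intro T V
    rw [← ENNReal.ofReal_mul (mul_nonneg (Real.exp_pos _).le (Real.rpow_nonneg (detF_nonneg _) _)),
      Matrix.add_mul, retr_add, neg_add, Real.exp_add]
    congr 1; ring
  have hmM : Measurable fun V : Matrix (Fin m) (Fin m) F =>
      ENNReal.ofReal (Real.exp (-retr (M * V)) * detF V ^ e) :=
    (((measurable_retr.comp (Continuous.measurable (by fun_prop))).neg.exp).mul
      (measurable_detF.pow_const _)).ennreal_ofReal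
  have hmT : Measurable fun z : Matrix (Fin m) (Fin n) F × Matrix (Fin m) (Fin m) F =>
      ENNReal.ofReal (Real.exp (-retr (z.1 * N * z.1ᴴ * z.2))) :=
    ((measurable_retr.comp (Continuous.measurable (by fun_prop))).neg.exp).ennreal_ofReal
  have step1 : ∀ T : Matrix (Fin m) (Fin n) F,
      lgamma F m a * ENNReal.ofReal (detF (M + T * N * Tᴴ) ^ (-a))
        = ∫⁻ V in {V : Matrix (Fin m) (Fin m) F | IsPosDef V},
            ENNReal.ofReal (Real.exp (-retr (M * V)) * detF V ^ e)
              * ENNReal.ofReal (Real.exp (-retr (T * N * Tᴴ * V))) ∂hermVolume F m := by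
    intro T
    have hP := hM.add_conj hN T
    rw [← lintegral_exp_retr_mul hP a, mul_right_comm,
      ← ENNReal.ofReal_mul (Real.rpow_nonneg (detF_nonneg _) _), ← Real.rpow_add hP.detF_pos,
      add_neg_cancel, Real.rpow_zero, ENNReal.ofReal_one, one_mul]
    simp_rw [← he, hret]
  rw [← lintegral_const_mul _ (measurable_ofReal_detF_add_conj M N (-a))]
  simp_rw [step1]
  rw [lintegral_lintegral_swap ((hmM.comp measurable_snd).mul hmT).aemeasurable]
  have step2 : ∀ V ∈ {V : Matrix (Fin m) (Fin m) F | IsPosDef V},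
      ∫⁻ T, ENNReal.ofReal (Real.exp (-retr (M * V)) * detF V ^ e)
              * ENNReal.ofReal (Real.exp (-retr (T * N * Tᴴ * V))) ∂matVolume F m n
        = ENNReal.ofReal (Real.pi ^ (m * n * rdim F / 2) * detF N ^ (-(rdim F * m / 2))) *
          ENNReal.ofReal (Real.exp (-retr (M * V)) *
            detF V ^ (a - rdim F * n / 2 - ((m : ℝ) - 1) * rdim F / 2 - 1)) := by
    intro V hV
    have hV : IsPosDef V := hV
    have hVp := hV.detF_pos
    have hNp := hN.detF_pos
    have hmV : Measurable fun T : Matrix (Fin m) (Fin n) F =>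
        ENNReal.ofReal (Real.exp (-retr (T * N * Tᴴ * V))) :=
      ((measurable_retr.comp (Continuous.measurable (by fun_prop))).neg.exp).ennreal_ofReal
    rw [lintegral_const_mul _ hmV]
    have hg := lintegral_gaussian (n := n) hV hN
    have hg' : ∫⁻ T, ENNReal.ofReal (Real.exp (-retr (T * N * Tᴴ * V))) ∂matVolume F m n
        = ENNReal.ofReal (detF V ^ (-(rdim F * n / 2)) * detF N ^ (-(rdim F * m / 2))) *
          ENNReal.ofReal (Real.pi ^ (m * n * rdim F / 2)) := by
      rw [← hg, ← mul_assoc, ← ENNReal.ofReal_mul (by positivity), Real.rpow_neg hVp.le,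
        Real.rpow_neg hNp.le]
      have : (detF V ^ (rdim F * n / 2))⁻¹ * (detF N ^ (rdim F * m / 2))⁻¹ *
          (detF V ^ (rdim F * n / 2) * detF N ^ (rdim F * m / 2)) = 1 := by
        have h1 : 0 < detF V ^ (rdim F * n / 2) := by positivity
        have h2 : 0 < detF N ^ (rdim F * m / 2) := by positivity
        field_simp
      rw [this, ENNReal.ofReal_one, one_mul]
    rw [hg', ← ENNReal.ofReal_mul (by positivity), ← ENNReal.ofReal_mul (by positivity),
      ← ENNReal.ofReal_mul (by positivity)]
    congr 1
    have hexp : a - rdim F * n / 2 - ((m : ℝ) - 1) * rdim F / 2 - 1 = e + -(rdim F * n / 2) := by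
      rw [he]; ring
    rw [hexp, Real.rpow_add hVp]
    ring
  rw [setLIntegral_congr_fun measurableSet_isPosDef step2, lintegral_const_mul]
  · have hMp := hM.detF_pos
    have hNp := hN.detF_pos
    rw [← lintegral_exp_retr_mul hM (a - rdim F * n / 2), ← mul_assoc,
      ← ENNReal.ofReal_mul (by positivity)]
    congr 2
    rw [Real.rpow_neg hMp.le]
    have h1 : 0 < detF M ^ (a - rdim F * n / 2) := by positivity
    field_simp
  · exact (((measurable_retr.comp (Continuous.measurable (by fun_prop))).neg.exp).mul
      (measurable_detF.pow_const _)).ennreal_ofReal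

end GammaIntegrals

/-! ### Finiteness and positivity of the Gamma function -/

section GammaFinite

variable {F : Type*} [NormedDivisionRing F] [StarRing F] [InnerProductSpace ℝ F]
  [RealNormedDivisionAlgebra F] {m n : ℕ}

theorem IsPosDef.two_mul_norm_le {A : Matrix (Fin n) (Fin n) F} (hA : IsPosDef A) {i j : Fin n}
    (hij : i ≠ j) : 2 * ‖A i j‖ ≤ inner ℝ (1 : F) (A i i) + inner ℝ (1 : F) (A j j) := by
  have hi := hA.diag_pos i
  have hj := hA.diag_pos j
  by_cases hz : A i j = 0
  · rw [hz]; simp; linarith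
  have hz' : 0 < ‖A i j‖ := norm_pos_iff.2 hz
  -- This unit scalar rotates `A i j` onto its norm, so the form at e_i - e_j u has real value A_ii
  -- + A_jj - 2‖A_ij‖.
  let u : F := ‖A i j‖⁻¹ • star (A i j)
  let x : Fin n → F := Pi.single i 1 - Pi.single j u
  have hx : x ≠ 0 := fun h => by simpa [x, hij] using congrFun h i
  have h := hA.2 x hx
  have hAx : A *ᵥ x = fun l => A l i - A l j * u := by
    simp only [x, Matrix.mulVec_sub, Matrix.mulVec_single]
    funext l; simp
  have hq : star x ⬝ᵥ (A *ᵥ x) = A i i - A i j * u - star u * (A j i - A j j * u) := by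
    rw [hAx]
    simp only [x, star_sub, ← Pi.single_star, star_one, sub_dotProduct, single_dotProduct, one_mul]
  have h1 : inner ℝ (1 : F) (A i j * u) = ‖A i j‖ := by
    simp only [u, mul_smul_comm, mul_star_self_eq, smul_smul, inner_smul_right, inner_one_one]
    field_simp
  have h2 : inner ℝ (1 : F) (star u * A j i) = ‖A i j‖ := by
    rw [← h1, ← inner_one_star, star_mul, star_star, hA.1.apply i j]
  have hu : ‖u‖ = 1 := by
    simp [u, norm_smul, norm_star_eq, hz'.ne']
  have h3 : inner ℝ (1 : F) (star u * (A j j * u)) = inner ℝ (1 : F) (A j j) := by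
    rw [hA.1.diag_eq j, smul_mul_assoc, one_mul, mul_smul_comm, inner_smul_right,
      inner_one_star_mul_self, hu, inner_smul_right, inner_one_one]
    ring
  rw [hq, mul_sub, inner_sub_right, inner_sub_right, inner_sub_right, h1, h2, h3] at h
  linarith

/-- Off-diagonal entries are bounded by means of diagonal ones, so on the cone etr(-A) decays in all
coordinates. -/
theorem norm_le_retr_hermOf {p : HermCoord F n} (hp : IsPosDef (hermOf p)) :
    ‖p‖ ≤ retr (hermOf p) := by
  have hd : ∀ i, inner ℝ (1 : F) (hermOf p i i) = p.1 i := fun i => by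
    rw [hermOf_diag, inner_smul_right, inner_one_one, mul_one]
  have hpos : ∀ i, 0 < p.1 i := fun i => hd i ▸ hp.diag_pos i
  have hr : retr (hermOf p) = ∑ i, p.1 i := by
    rw [retr_eq_sum]; exact Finset.sum_congr rfl fun i _ => hd i
  have h0 : 0 ≤ ∑ i, p.1 i := Finset.sum_nonneg fun i _ => (hpos i).le
  have hle : ∀ i, p.1 i ≤ ∑ i, p.1 i := fun i =>
    Finset.single_le_sum (fun i _ => (hpos i).le) (Finset.mem_univ i)
  rw [hr, Prod.norm_def]
  refine max_le ((pi_norm_le_iff_of_nonneg h0).2 fun i => ?_)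
    ((pi_norm_le_iff_of_nonneg h0).2 fun q => ?_)
  · rw [Real.norm_of_nonneg (hpos i).le]; exact hle i
  · have h := hp.two_mul_norm_le q.2.ne
    rw [hermOf_of_lt p q.2, hd, hd] at h
    have h1 := hle q.1.1
    have h2 := hle q.1.2
    linarith

theorem exp_neg_le_rpow {k : ℕ} (hk : 1 ≤ k) {s t : ℝ} (hs : 0 ≤ s) (hst : s ≤ t) :
    Real.exp (-t) ≤ (k : ℝ) ^ k * (1 + s) ^ (-(k : ℝ)) := by
  have hk' : (1 : ℝ) ≤ k := by exact_mod_cast hk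
  have h1 : (1 + s) / k ≤ Real.exp (s / k) := by
    refine le_trans ?_ (Real.add_one_le_exp _)
    rw [add_div, add_comm]
    gcongr
    exact div_le_one_of_le₀ hk' (by linarith)
  have h2 : ((1 + s) / k) ^ k ≤ Real.exp s := by
    have := pow_le_pow_left₀ (by positivity) h1 k
    rwa [← Real.exp_nat_mul, mul_div_cancel₀ _ (by positivity)] at this
  calc Real.exp (-t) ≤ Real.exp (-s) := Real.exp_le_exp.2 (by linarith)
    _ = (Real.exp s)⁻¹ := Real.exp_neg s
    _ ≤ (((1 + s) / k) ^ k)⁻¹ := inv_anti₀ (by positivity) h2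
    _ = _ := by
      rw [Real.rpow_neg (by positivity), Real.rpow_natCast, div_pow, inv_div, div_eq_mul_inv]

variable [FiniteDimensional ℝ F] [MeasurableSpace F] [BorelSpace F]

theorem measurable_gammaDensity (e : ℝ) : Measurable fun A : Matrix (Fin n) (Fin n) F =>
    ENNReal.ofReal (Real.exp (-retr A) * detF A ^ e) :=
  (measurable_retr.neg.exp.mul (measurable_detF.pow_const _)).ennreal_ofReal

theorem lgamma_eq_lintegral_coord (a : ℝ) :
    lgamma F n a = ∫⁻ p in {p : HermCoord F n | IsPosDef (hermOf p)}, ENNReal.ofReal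
      (Real.exp (-retr (hermOf p)) *
        detF (hermOf p) ^ (a - ((n : ℝ) - 1) * rdim F / 2 - 1)) := by
  rw [lgamma, hermVolume_eq_map,
    setLIntegral_map measurableSet_isPosDef (measurable_gammaDensity _) measurable_hermOf]
  rfl

theorem lgamma_ne_zero (a : ℝ) : lgamma F n a ≠ 0 := by
  have hm : Measurable fun p : HermCoord F n => ENNReal.ofReal (Real.exp (-retr (hermOf p)) *
      detF (hermOf p) ^ (a - ((n : ℝ) - 1) * rdim F / 2 - 1)) :=
    (measurable_gammaDensity _).comp measurable_hermOf
  rw [lgamma_eq_lintegral_coord, ← pos_iff_ne_zero, setLIntegral_pos_iff hm]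
  have hsub : {p : HermCoord F n | IsPosDef (hermOf p)} ⊆ Function.support fun p : HermCoord F n =>
      ENNReal.ofReal (Real.exp (-retr (hermOf p)) *
        detF (hermOf p) ^ (a - ((n : ℝ) - 1) * rdim F / 2 - 1)) := by
    intro p hp
    have hp : IsPosDef (hermOf p) := hp
    have := hp.detF_pos
    exact (ENNReal.ofReal_pos.2 (by positivity)).ne'
  rw [Set.inter_eq_self_of_subset_right hsub]
  refine isOpen_isPosDef_hermOf.measure_pos _ ⟨coordLin F n 1, ?_⟩
  change IsPosDef _
  rw [hermOf_coordLin Matrix.isHermitian_one]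
  exact isPosDef_one

variable (F n) in
theorem lgamma_base_lt_top : lgamma F n (((n : ℝ) - 1) * rdim F / 2 + 1) < ⊤ := by
  rw [lgamma_eq_lintegral_coord]
  -- One more than the real dimension, so that (1 + ‖p‖)^(-k) is integrable. At this value of the
  -- parameter the determinant has exponent 0 and only the exponential is left to bound.
  set k : ℕ := Module.finrank ℝ (HermCoord F n) + 1 with hk
  have hint : Integrable (fun p : HermCoord F n => (k : ℝ) ^ k * (1 + ‖p‖) ^ (-(k : ℝ))) volume :=
    (integrable_one_add_norm (by rw [hk]; push_cast; linarith)).const_mul _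
  refine lt_of_le_of_lt (lintegral_mono_ae ?_) (lt_of_le_of_lt (setLIntegral_le_lintegral _ _)
    hint.lintegral_lt_top)
  refine (ae_restrict_iff' isOpen_isPosDef_hermOf.measurableSet).2
    (Filter.Eventually.of_forall fun p hp => ENNReal.ofReal_le_ofReal ?_)
  rw [show ((n : ℝ) - 1) * rdim F / 2 + 1 - ((n : ℝ) - 1) * rdim F / 2 - 1 = 0 by ring,
    Real.rpow_zero, mul_one]
  exact exp_neg_le_rpow (by omega) (norm_nonneg p) (norm_le_retr_hermOf hp)

theorem detF_fin_one {A : Matrix (Fin 1) (Fin 1) F} (hA : IsPosDef A) :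
    detF A = inner ℝ (1 : F) (A 0 0) := by
  have hA' : A = (diagUnit (fun _ : Fin 1 => inner ℝ (1 : F) (A 0 0))
      fun _ => (hA.diag_pos 0).ne' : (Matrix (Fin 1) (Fin 1) F)ˣ).val := by
    ext i j
    fin_cases i; fin_cases j
    exact hA.1.diag_eq 0
  conv_lhs => rw [hA']
  rw [detF_diagUnit (fun _ : Fin 1 => inner ℝ (1 : F) (A 0 0)) fun _ => hA.diag_pos 0]
  simp

/-- Sylvester's identity collapses the determinant to the scalar 1 + Σ‖T_i‖², which dominates the
sup norm. -/
theorem one_add_norm_sq_le_detF (T : Matrix (Fin m) (Fin 1) F) :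
    1 + @norm (Fin m → Fin 1 → F) _ T ^ 2
      ≤ detF (1 + T * (1 : Matrix (Fin 1) (Fin 1) F) * Tᴴ) := by
  have hP : IsPosDef (1 + Tᴴ * T) := by
    have := (isPosDef_one (F := F) (n := 1)).add_conj (isPosDef_one (F := F) (n := m)) Tᴴ
    simpa using this
  rw [Matrix.mul_one, detF_one_add_mul_comm, detF_fin_one hP, Matrix.add_apply,
    Matrix.one_apply_eq, inner_add_right, inner_one_one, Matrix.mul_apply, inner_sum]
  simp only [Matrix.conjTranspose_apply, inner_one_star_mul_self]
  gcongr
  have h0 : 0 ≤ ∑ i, ‖T i 0‖ ^ 2 := Finset.sum_nonneg fun i _ => by positivity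
  refine (Real.le_sqrt (norm_nonneg _) h0).1 ?_
  refine (pi_norm_le_iff_of_nonneg (Real.sqrt_nonneg _)).2 fun i =>
    (pi_norm_le_iff_of_nonneg (Real.sqrt_nonneg _)).2 fun j => ?_
  rw [Subsingleton.elim j 0, Real.le_sqrt (norm_nonneg _) h0]
  exact Finset.single_le_sum (f := fun i => ‖T i 0‖ ^ 2) (fun i _ => by positivity)
    (Finset.mem_univ i)

theorem lintegral_detF_column_lt_top {a : ℝ} (ha : rdim F * m / 2 < a) :
    ∫⁻ T : Matrix (Fin m) (Fin 1) F, ENNReal.ofReal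
      (detF (1 + T * (1 : Matrix (Fin 1) (Fin 1) F) * Tᴴ) ^ (-a)) ∂matVolume F m 1 < ⊤ := by
  have ha0 : 0 < a := lt_of_le_of_lt (by have := rdim_pos F; positivity) ha
  have hfin : (Module.finrank ℝ (Fin m → Fin 1 → F) : ℝ) < 2 * a := by
    rw [Module.finrank_pi_fintype]
    simp only [Module.finrank_pi_fintype, Finset.sum_const, Finset.card_univ, Fintype.card_fin]
    rw [rdim] at ha
    simp only [smul_eq_mul, Nat.cast_mul, one_mul]
    linarith
  have hint := integrable_rpow_neg_one_add_norm_sq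
    (μ := (volume : Measure (Fin m → Fin 1 → F))) hfin
  refine lt_of_le_of_lt (lintegral_mono fun T => ENNReal.ofReal_le_ofReal ?_)
    hint.lintegral_lt_top
  rw [show -(2 * a) / 2 = -a by ring]
  exact Real.rpow_le_rpow_of_nonpos (by positivity) (one_add_norm_sq_le_detF T) (by linarith)

theorem lintegral_detF_add_conj_ne_zero {M : Matrix (Fin m) (Fin m) F} (hM : IsPosDef M)
    {N : Matrix (Fin n) (Fin n) F} (hN : IsPosDef N) (s : ℝ) :
    ∫⁻ T, ENNReal.ofReal (detF (M + T * N * Tᴴ) ^ s) ∂matVolume F m n ≠ 0 := by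
  rw [← pos_iff_ne_zero, lintegral_pos_iff_support (measurable_ofReal_detF_add_conj M N s)]
  have hs : (Function.support fun T : Matrix (Fin m) (Fin n) F =>
      ENNReal.ofReal (detF (M + T * N * Tᴴ) ^ s)) = Set.univ := by
    refine Set.eq_univ_of_forall fun T => ?_
    have := (hM.add_conj hN T).detF_pos
    exact (ENNReal.ofReal_pos.2 (by positivity)).ne'
  rw [hs]
  exact isOpen_univ.measure_pos (volume : Measure (Fin m → Fin n → F)) Set.univ_nonempty

/-- This recursion stands in for the product formula. The column integral is never 0, so finiteness
passes from a to a + β/2; it is finite for a > (m-1)β/2, so there finiteness also passes back. -/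
theorem lgamma_step (a : ℝ) :
    lgamma F m (a + rdim F / 2) * ∫⁻ T : Matrix (Fin m) (Fin 1) F, ENNReal.ofReal
      (detF (1 + T * (1 : Matrix (Fin 1) (Fin 1) F) * Tᴴ) ^ (-(a + rdim F / 2))) ∂matVolume F m 1
      = ENNReal.ofReal (Real.pi ^ (m * rdim F / 2)) * lgamma F m a := by
  have h := lgamma_mul_lintegral (isPosDef_one (F := F) (n := m)) (isPosDef_one (F := F) (n := 1))
    (a + rdim F / 2)
  rw [h, detF_one, detF_one, Real.one_rpow, Real.one_rpow]
  simp

theorem lgamma_add_lt_top {a : ℝ} (h : lgamma F m a < ⊤) : lgamma F m (a + rdim F / 2) < ⊤ := by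
  have hs := lgamma_step (F := F) (m := m) a
  by_contra ht
  rw [not_lt_top_iff.1 ht, ENNReal.top_mul
    (lintegral_detF_add_conj_ne_zero isPosDef_one isPosDef_one _)] at hs
  exact (ENNReal.mul_lt_top ENNReal.ofReal_lt_top h).ne hs.symm

theorem lgamma_lt_top_of_add {a : ℝ} (ha : ((m : ℝ) - 1) * rdim F / 2 < a)
    (h : lgamma F m (a + rdim F / 2) < ⊤) : lgamma F m a < ⊤ := by
  have hs := lgamma_step (F := F) (m := m) a
  by_contra ht
  have hpi : ENNReal.ofReal (Real.pi ^ (m * rdim F / 2)) ≠ 0 :=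
    (ENNReal.ofReal_pos.2 (by positivity)).ne'
  rw [not_lt_top_iff.1 ht, ENNReal.mul_top hpi] at hs
  refine (ENNReal.mul_lt_top h (lintegral_detF_column_lt_top ?_)).ne hs
  linarith

/-- Pointwise, |A|^b is bounded by |A|^c where |A| ≥ 1 and by |A|^a where |A| ≤ 1. -/
theorem lgamma_le_add {a b c : ℝ} (hab : a ≤ b) (hbc : b ≤ c) :
    lgamma F n b ≤ lgamma F n a + lgamma F n c := by
  rw [lgamma, lgamma, lgamma, ← lintegral_add_left (measurable_gammaDensity _)]
  refine lintegral_mono_ae ((ae_restrict_iff' measurableSet_isPosDef).2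
    (Filter.Eventually.of_forall fun A hA => ?_))
  have hA : IsPosDef A := hA
  have hp := hA.detF_pos
  rw [← ENNReal.ofReal_add (by positivity) (by positivity), ← mul_add]
  refine ENNReal.ofReal_le_ofReal (mul_le_mul_of_nonneg_left ?_ (Real.exp_pos _).le)
  rcases le_total 1 (detF A) with h1 | h1
  · exact le_add_of_nonneg_of_le (by positivity)
      (Real.rpow_le_rpow_of_exponent_le h1 (by linarith))
  · exact le_add_of_le_of_nonneg
      (Real.rpow_le_rpow_of_exponent_ge hp h1 (by linarith)) (by positivity)

/-- Climb from the base value in steps of β/2, interpolate to reach every larger parameter, then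
descend in the same steps as far as the bound (m-1)β/2 allows. -/
theorem lgamma_lt_top {a : ℝ} (ha : ((m : ℝ) - 1) * rdim F / 2 < a) : lgamma F m a < ⊤ := by
  have hβ := rdim_pos F
  set a₀ : ℝ := ((m : ℝ) - 1) * rdim F / 2 + 1 with ha₀
  have up : ∀ k : ℕ, lgamma F m (a₀ + k * (rdim F / 2)) < ⊤ := by
    intro k
    induction k with
    | zero => simpa using lgamma_base_lt_top F m
    | succ k ih =>
      have := lgamma_add_lt_top ih
      rwa [show a₀ + k * (rdim F / 2) + rdim F / 2 = a₀ + ((k + 1 : ℕ) : ℝ) * (rdim F / 2) by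
        push_cast; ring] at this
  have large : ∀ b, a₀ ≤ b → lgamma F m b < ⊤ := by
    intro b hb
    obtain ⟨k, hk⟩ := exists_nat_ge ((b - a₀) / (rdim F / 2))
    have hk' : b ≤ a₀ + k * (rdim F / 2) := by
      rw [div_le_iff₀ (by positivity)] at hk
      linarith
    exact (lgamma_le_add hb hk').trans_lt (ENNReal.add_lt_top.2 ⟨lgamma_base_lt_top F m, up k⟩)
  have down : ∀ k : ℕ, ∀ b : ℝ, ((m : ℝ) - 1) * rdim F / 2 < b → a₀ ≤ b + k * (rdim F / 2) →
      lgamma F m b < ⊤ := by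
    intro k
    induction k with
    | zero => intro b _ h; exact large b (by simpa using h)
    | succ k ih =>
      intro b hb h
      refine lgamma_lt_top_of_add hb (ih _ (by linarith) ?_)
      push_cast at h
      linarith
  obtain ⟨k, hk⟩ := exists_nat_ge ((a₀ - a) / (rdim F / 2))
  rw [div_le_iff₀ (by positivity)] at hk
  exact down k a ha (by linarith)

theorem mvGamma_eq_toReal (a : ℝ) : mvGamma F n a = (lgamma F n a).toReal := by
  rw [mvGamma, lgamma, integral_eq_lintegral_of_nonneg_ae]
  · exact Filter.Eventually.of_forall fun A =>
      mul_nonneg (Real.exp_pos _).le (Real.rpow_nonneg (detF_nonneg _) _)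
  · exact (measurable_retr.neg.exp.mul (measurable_detF.pow_const _)).aestronglyMeasurable

theorem mvGamma_pos {a : ℝ} (ha : ((n : ℝ) - 1) * rdim F / 2 < a) : 0 < mvGamma F n a := by
  rw [mvGamma_eq_toReal]
  exact ENNReal.toReal_pos (lgamma_ne_zero a) (lgamma_lt_top ha).ne

theorem ofReal_mvGamma {a : ℝ} (ha : ((n : ℝ) - 1) * rdim F / 2 < a) :
    ENNReal.ofReal (mvGamma F n a) = lgamma F n a := by
  rw [mvGamma_eq_toReal, ENNReal.ofReal_toReal (lgamma_lt_top ha).ne]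

end GammaFinite

/-- Inversion is continuous on the open set of units and takes the default value 0 elsewhere. -/
theorem _root_.NormedRing.measurable_inverse {R : Type*} [NormedRing R] [HasSummableGeomSeries R]
    [MeasurableSpace R] [BorelSpace R] : Measurable (Ring.inverse : R → R) := by
  classical
  have hpw : (Ring.inverse : R → R) = {A | IsUnit A}.piecewise Ring.inverse fun _ => 0 := by
    funext A
    by_cases hA : IsUnit A
    · rw [Set.piecewise_eq_of_mem _ _ _ (by exact hA)]
    · rw [Set.piecewise_eq_of_notMem _ _ _ (by exact hA), Ring.inverse_non_unit A hA]
  have hcont : ContinuousOn (Ring.inverse : R → R) {A | IsUnit A} := by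
    rintro A ⟨u, rfl⟩
    exact (NormedRing.inverse_continuousAt u).continuousWithinAt
  rw [hpw]
  exact hcont.measurable_piecewise continuousOn_const (Units.isOpen).measurableSet

/-! ### Kernels of the normal, Wishart and T laws -/

section Laws

variable {F : Type*} [NormedDivisionRing F] [StarRing F] [InnerProductSpace ℝ F]
  [RealNormedDivisionAlgebra F] [FiniteDimensional ℝ F] [MeasurableSpace F] [BorelSpace F]
  {m n : ℕ}

theorem measurable_ringInverse :
    Measurable (Ring.inverse : Matrix (Fin n) (Fin n) F → Matrix (Fin n) (Fin n) F) := by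
  -- Any complete ring norm inducing the product topology serves; it is used only to get continuity
  -- of inversion.
  let N : NormedRing (Matrix (Fin n) (Fin n) F) := Matrix.linftyOpNormedRing
  have hB : @BorelSpace (Matrix (Fin n) (Fin n) F) N.toMetricSpace.toUniformSpace.toTopologicalSpace
      _ := inferInstanceAs (BorelSpace (Fin n → Fin n → F))
  have hC : @CompleteSpace (Matrix (Fin n) (Fin n) F) N.toMetricSpace.toUniformSpace :=
    inferInstanceAs (CompleteSpace (Fin n → Fin n → F))
  have hS : @HasSummableGeomSeries (Matrix (Fin n) (Fin n) F) N := inferInstance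
  exact @NormedRing.measurable_inverse _ N hS _ hB

theorem isUnit_of_isPosDef_mul_conjTranspose {L : Matrix (Fin n) (Fin n) F}
    (h : IsPosDef (L * Lᴴ)) : IsUnit L := by
  obtain ⟨B, hB⟩ := h.isUnit.exists_right_inv
  rw [Matrix.mul_assoc] at hB
  exact IsUnit.of_mul_eq_one _ hB

theorem detF_mul_conjTranspose_self_rpow (L : Matrix (Fin n) (Fin n) F) (s : ℝ) :
    detF (L * Lᴴ) ^ (s / 2) = detF L ^ s := by
  have h := detF_conjTranspose_mul_self_rpow Lᴴ s
  rwa [Matrix.conjTranspose_conjTranspose, detF_conjTranspose] at h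

/-- The normalizing constant of the matrix normal law `N(0, A ⊗ I)`. -/
def normalConst (n : ℕ) (A : Matrix (Fin m) (Fin m) F) : ℝ :=
  1 / ((2 * Real.pi / rdim F) ^ (rdim F * m * n / 2) * detF A ^ (rdim F * n / 2)
    * detF (1 : Matrix (Fin n) (Fin n) F) ^ (rdim F * m / 2))

theorem normalConst_nonneg (A : Matrix (Fin m) (Fin m) F) : 0 ≤ normalConst n A := by
  have := rdim_pos F
  have h1 := detF_nonneg A
  have h2 := detF_nonneg (1 : Matrix (Fin n) (Fin n) F)
  unfold normalConst
  positivity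

/-- The density of `X L⁻¹` as a function of `V = L Lᴴ`, for `X` normal. -/
def scaleKernel (Ξ : Matrix (Fin m) (Fin m) F) (T : Matrix (Fin m) (Fin n) F)
    (V : Matrix (Fin n) (Fin n) F) : ENNReal :=
  ENNReal.ofReal (detF V ^ (rdim F * m / 2)) * ENNReal.ofReal
    (normalConst n (Ring.inverse Ξ) * Real.exp (-(rdim F / 2 * retr (Ξ * T * V * Tᴴ))))

theorem measurable_scaleKernel (Ξ : Matrix (Fin m) (Fin m) F) (μ : Matrix (Fin m) (Fin n) F) :
    Measurable fun z : Matrix (Fin n) (Fin n) F × Matrix (Fin m) (Fin n) F =>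
      scaleKernel Ξ (z.2 - μ) z.1 := by
  have h : Continuous fun z : Matrix (Fin n) (Fin n) F × Matrix (Fin m) (Fin n) F =>
      Ξ * (z.2 - μ) * z.1 * (z.2 - μ)ᴴ := by fun_prop
  exact ((measurable_detF.comp measurable_fst).pow_const _).ennreal_ofReal.mul
    ((((measurable_retr.comp h.measurable).const_mul _).neg.exp).const_mul _).ennreal_ofReal

/-- The substitution X = (T - μ)L, with Jacobian |L|^(βm) = |LLᴴ|^(βm/2). The resulting density sees
`L` only through `L * Lᴴ`. -/
theorem lintegral_matrixNormal {Ξ : Matrix (Fin m) (Fin m) F} (hΞ : IsPosDef Ξ)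
    {L : Matrix (Fin n) (Fin n) F} (hL : IsUnit L) (μ : Matrix (Fin m) (Fin n) F)
    {f : Matrix (Fin m) (Fin n) F → ENNReal} (hf : Measurable f) :
    ∫⁻ X, f (X * Ring.inverse L + μ) ∂matrixNormal 0 (Ring.inverse Ξ) (1 : Matrix (Fin n) (Fin n) F)
      = ∫⁻ T, scaleKernel Ξ (T - μ) (L * Lᴴ) * f T ∂matVolume F m n := by
  let ρ : Matrix (Fin m) (Fin n) F → ENNReal := fun Y => ENNReal.ofReal
    (normalConst n (Ring.inverse Ξ) * Real.exp (-(rdim F / 2 * retr (Ξ * Y * Yᴴ))))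
  have hlaw : matrixNormal 0 (Ring.inverse Ξ) (1 : Matrix (Fin n) (Fin n) F)
      = (matVolume F m n).withDensity ρ := by
    simp only [matrixNormal, ρ, normalConst, Ring.inverse_inverse hΞ.isUnit, sub_zero,
      Ring.inverse_one, Matrix.mul_one]
  have hc : Continuous fun Y : Matrix (Fin m) (Fin n) F => Ξ * Y * Yᴴ := by fun_prop
  have hρ : Measurable ρ :=
    ((((measurable_retr.comp hc.measurable).const_mul _).neg.exp).const_mul _).ennreal_ofReal
  have hg : Measurable fun X : Matrix (Fin m) (Fin n) F => f (X * Ring.inverse L + μ) :=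
    hf.comp (Continuous.measurable (by fun_prop))
  rw [hlaw, lintegral_withDensity_eq_lintegral_mul _ hρ hg]
  rw [← lintegral_matVolume_mul_right hL (hρ.mul hg)]
  simp only [Pi.mul_apply]
  have hcan : ∀ X : Matrix (Fin m) (Fin n) F, X * L * Ring.inverse L = X := fun X => by
    rw [Matrix.mul_assoc, Ring.mul_inverse_cancel _ hL, Matrix.mul_one]
  simp_rw [hcan]
  have hm : Measurable fun X : Matrix (Fin m) (Fin n) F => ρ ((X - μ) * L) * f (X - μ + μ) :=
    (hρ.comp (Continuous.measurable (by fun_prop))).mul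
      (hf.comp (Continuous.measurable (by fun_prop)))
  rw [← lintegral_matVolume_sub μ, ← lintegral_const_mul _ hm]
  refine lintegral_congr fun T => ?_
  have h1 : Ξ * ((T - μ) * L) * ((T - μ) * L)ᴴ = Ξ * (T - μ) * (L * Lᴴ) * (T - μ)ᴴ := by
    simp only [Matrix.conjTranspose_mul, Matrix.mul_assoc]
  simp only [sub_add_cancel, ρ, scaleKernel, h1,
    detF_mul_conjTranspose_self_rpow]
  rw [mul_assoc]

/-- The unnormalized density of the matricvariate `T` law. -/
def tKernel (Ξ : Matrix (Fin m) (Fin m) F) (S : Matrix (Fin n) (Fin n) F) (a : ℝ)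
    (T : Matrix (Fin m) (Fin n) F) : ENNReal :=
  ENNReal.ofReal (detF (Ring.inverse Ξ + T * Ring.inverse S * Tᴴ) ^ (-a))

theorem measurable_tKernel (Ξ : Matrix (Fin m) (Fin m) F) (S : Matrix (Fin n) (Fin n) F) (a : ℝ)
    (μ : Matrix (Fin m) (Fin n) F) :
    Measurable fun T => tKernel Ξ S a (T - μ) :=
  (measurable_ofReal_detF_add_conj _ _ _).comp (Continuous.measurable (by fun_prop))

/-- Factor out `S`, apply Sylvester, then factor out `Ξ`. This carries the n × n determinant
produced by the Wishart integral to the m × m one in the T density. -/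
theorem detF_add_conj_comm {Ξ : Matrix (Fin m) (Fin m) F} (hΞ : IsPosDef Ξ)
    {S : Matrix (Fin n) (Fin n) F} (hS : IsPosDef S) (T : Matrix (Fin m) (Fin n) F) :
    detF (S + Tᴴ * Ξ * T)
      = detF S * detF Ξ * detF (Ring.inverse Ξ + T * Ring.inverse S * Tᴴ) := by
  have h1 : S + Tᴴ * Ξ * T = S * (1 + (Ring.inverse S * Tᴴ) * (Ξ * T)) := by
    rw [Matrix.mul_add, Matrix.mul_one]
    simp only [← Matrix.mul_assoc]
    rw [Ring.mul_inverse_cancel _ hS.isUnit, Matrix.one_mul]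
  have h2 : 1 + (Ξ * T) * (Ring.inverse S * Tᴴ)
      = Ξ * (Ring.inverse Ξ + T * Ring.inverse S * Tᴴ) := by
    rw [Matrix.mul_add, Ring.mul_inverse_cancel _ hΞ.isUnit]
    simp only [Matrix.mul_assoc]
  rw [h1, detF_mul, detF_one_add_mul_comm, h2, detF_mul, mul_assoc]

/-- The normalizing constant of the Wishart law. -/
def wishartConst (N : ℝ) (S : Matrix (Fin n) (Fin n) F) : ℝ :=
  1 / ((2 / rdim F) ^ (rdim F * n * N / 2) * mvGamma F n (rdim F * N / 2)
    * detF S ^ (rdim F * N / 2))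

theorem wishartConst_nonneg (N : ℝ) (S : Matrix (Fin n) (Fin n) F) : 0 ≤ wishartConst N S := by
  have := rdim_pos F
  have h1 := detF_nonneg S
  have h2 : 0 ≤ mvGamma F n (rdim F * N / 2) := by
    rw [mvGamma_eq_toReal]; exact ENNReal.toReal_nonneg
  unfold wishartConst
  positivity

/-- The density of the Wishart law `W(N, S⁻¹)`. -/
def wishartKernel (N : ℝ) (S V : Matrix (Fin n) (Fin n) F) : ENNReal :=
  ENNReal.ofReal (wishartConst N (Ring.inverse S) * detF V ^ (rdim F * (N - n + 1) / 2 - 1)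
    * Real.exp (-(rdim F / 2 * retr (S * V))))

theorem measurable_wishartKernel (N : ℝ) (S : Matrix (Fin n) (Fin n) F) :
    Measurable (wishartKernel N S) := by
  have hc : Continuous fun V : Matrix (Fin n) (Fin n) F => S * V := by fun_prop
  exact ((measurable_detF.pow_const _).const_mul _ |>.mul
    (((measurable_retr.comp hc.measurable).const_mul _).neg.exp)).ennreal_ofReal

theorem wishart_eq {S : Matrix (Fin n) (Fin n) F} (hS : IsPosDef S) (N : ℝ) :
    wishart N (Ring.inverse S)
      = ((hermVolume F n).restrict {V | IsPosDef V}).withDensity (wishartKernel N S) := by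
  simp only [wishart, Ring.inverse_inverse hS.isUnit]
  rfl

/-- The product of kernels is a Gamma integrand in V with matrix (β/2)(S + TᴴΞT). The constant is
left existential: only its independence of `T` matters, since total mass determines it later. -/
theorem exists_lintegral_wishartKernel_mul_scaleKernel {Ξ : Matrix (Fin m) (Fin m) F}
    (hΞ : IsPosDef Ξ) {S : Matrix (Fin n) (Fin n) F} (hS : IsPosDef S) (ν : ℝ) :
    ∃ C : ENNReal, ∀ T : Matrix (Fin m) (Fin n) F,
      ∫⁻ V in {V : Matrix (Fin n) (Fin n) F | IsPosDef V},
        wishartKernel (ν + n - m) S V * scaleKernel Ξ T V ∂hermVolume F n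
        = C * tKernel Ξ S (rdim F * (n + ν) / 2) T := by
  have hβ := rdim_pos F
  set a : ℝ := rdim F * (n + ν) / 2 with ha
  set c : ℝ := wishartConst (ν + n - m) (Ring.inverse S) * normalConst n (Ring.inverse Ξ) with hc
  have hc0 : 0 ≤ c := mul_nonneg (wishartConst_nonneg _ _) (normalConst_nonneg _)
  -- The factor contributed by β/2; its value is irrelevant, only its positivity is used.
  set κ : ℝ := detF ((rdim F / 2) • (1 : Matrix (Fin n) (Fin n) F)) with hκ
  have hκ0 : 0 < κ := (isPosDef_one.smul (by positivity)).detF_pos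
  refine ⟨ENNReal.ofReal c * ENNReal.ofReal ((κ * (detF S * detF Ξ)) ^ (-a)) * lgamma F n a,
    fun T => ?_⟩
  have hB : IsPosDef (S + Tᴴ * Ξ * T) := by
    simpa using hS.add_conj hΞ Tᴴ
  set A : Matrix (Fin n) (Fin n) F := (rdim F / 2) • (S + Tᴴ * Ξ * T) with hA
  have hAp : IsPosDef A := hB.smul (by positivity)
  have hdA : detF A = κ * (detF S * detF Ξ) *
      detF (Ring.inverse Ξ + T * Ring.inverse S * Tᴴ) := by
    have : A = ((rdim F / 2) • (1 : Matrix (Fin n) (Fin n) F)) * (S + Tᴴ * Ξ * T) := by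
      rw [Matrix.smul_mul, Matrix.one_mul]
    rw [this, detF_mul, detF_add_conj_comm hΞ hS, ← hκ]
    ring
  have hpt : ∀ V ∈ {V : Matrix (Fin n) (Fin n) F | IsPosDef V},
      wishartKernel (ν + n - m) S V * scaleKernel Ξ T V
        = ENNReal.ofReal c * ENNReal.ofReal (Real.exp (-retr (A * V)) *
            detF V ^ (a - ((n : ℝ) - 1) * rdim F / 2 - 1)) := by
    intro V hV
    have hV : IsPosDef V := hV
    have hVp := hV.detF_pos
    have hr : retr (A * V) = rdim F / 2 * retr (S * V) + rdim F / 2 * retr (Ξ * T * V * Tᴴ) := by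
      have h1 : retr (Ξ * T * V * Tᴴ) = retr (Tᴴ * Ξ * T * V) := by
        rw [retr_mul_comm]; simp only [Matrix.mul_assoc]
      rw [hA, Matrix.smul_mul, retr_smul, Matrix.add_mul, retr_add, h1]
      ring
    have he : a - ((n : ℝ) - 1) * rdim F / 2 - 1
        = (rdim F * (ν + n - m - n + 1) / 2 - 1) + rdim F * m / 2 := by
      rw [ha]; ring
    have h1 := wishartConst_nonneg (ν + n - m) (Ring.inverse S)
    rw [wishartKernel, scaleKernel, ← ENNReal.ofReal_mul (by positivity),
      ← ENNReal.ofReal_mul (by positivity), ← ENNReal.ofReal_mul hc0, hr, neg_add, Real.exp_add,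
      he, Real.rpow_add hVp, hc]
    congr 1
    ring
  have hm : Measurable fun V : Matrix (Fin n) (Fin n) F => ENNReal.ofReal
      (Real.exp (-retr (A * V)) * detF V ^ (a - ((n : ℝ) - 1) * rdim F / 2 - 1)) :=
    (((measurable_retr.comp (Continuous.measurable (by fun_prop))).neg.exp).mul
      (measurable_detF.pow_const _)).ennreal_ofReal
  have hD := (hΞ.inverse.add_conj hS.inverse T).detF_pos
  have hSp := hS.detF_pos
  have hΞp := hΞ.detF_pos
  rw [setLIntegral_congr_fun measurableSet_isPosDef hpt, lintegral_const_mul _ hm,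
    ← lintegral_exp_retr_mul hAp a, tKernel]
  have hone : ENNReal.ofReal ((κ * (detF S * detF Ξ)) ^ (-a)) *
      ENNReal.ofReal (detF (Ring.inverse Ξ + T * Ring.inverse S * Tᴴ) ^ (-a)) *
      ENNReal.ofReal (detF A ^ a) = 1 := by
    rw [← ENNReal.ofReal_mul (by positivity), ← ENNReal.ofReal_mul (by positivity),
      ← Real.mul_rpow (by positivity) hD.le, ← hdA, ← Real.rpow_add hAp.detF_pos, neg_add_cancel,
      Real.rpow_zero, ENNReal.ofReal_one]
  generalize ∫⁻ V in {V : Matrix (Fin n) (Fin n) F | IsPosDef V}, ENNReal.ofReal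
      (Real.exp (-retr (A * V)) * detF V ^ (a - ((n : ℝ) - 1) * rdim F / 2 - 1))
      ∂hermVolume F n = J
  generalize ENNReal.ofReal ((κ * (detF S * detF Ξ)) ^ (-a)) = x at hone ⊢
  generalize ENNReal.ofReal (detF (Ring.inverse Ξ + T * Ring.inverse S * Tᴴ) ^ (-a)) = y at hone ⊢
  generalize ENNReal.ofReal (detF A ^ a) = z at hone ⊢
  calc ENNReal.ofReal c * J = ENNReal.ofReal c * (x * y * z) * J := by rw [hone, mul_one]
    _ = _ := by ring

/-- The mass is `lgamma_mul_lintegral` at `Ξ⁻¹` and `S⁻¹`. The condition on `ν` makes both Gamma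
values finite and positive, so that the real constants in the density match the extended ones. -/
theorem matricvariateT_eq (ν : ℝ) (μ : Matrix (Fin m) (Fin n) F) {Ξ : Matrix (Fin m) (Fin m) F}
    {S : Matrix (Fin n) (Fin n) F} (hν : (m : ℝ) - 1 < ν) (hΞ : IsPosDef Ξ) (hS : IsPosDef S) :
    ∃ C : ENNReal, matricvariateT ν μ Ξ S = C • (matVolume F m n).withDensity
        (fun T => tKernel Ξ S (rdim F * (n + ν) / 2) (T - μ)) ∧
      C * ∫⁻ T, tKernel Ξ S (rdim F * (n + ν) / 2) (T - μ) ∂matVolume F m n = 1 := by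
  have hβ := rdim_pos F
  have hSp := hS.detF_pos
  have hΞp := hΞ.detF_pos
  set a : ℝ := rdim F * (n + ν) / 2 with ha
  have hb : a - rdim F * n / 2 = rdim F * ν / 2 := by rw [ha]; ring
  have hνβ : ((m : ℝ) - 1) * rdim F / 2 < rdim F * ν / 2 := by
    have := mul_lt_mul_of_pos_left hν hβ
    linarith
  have haβ : ((m : ℝ) - 1) * rdim F / 2 < a := by
    have : 0 ≤ rdim F * n / 2 := by positivity
    linarith
  have hG1 := mvGamma_pos (F := F) (n := m) haβ
  have hG2 := mvGamma_pos (F := F) (n := m) hνβ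
  set D : ℝ := Real.pi ^ (m * n * rdim F / 2) * mvGamma F m (rdim F * ν / 2)
    * detF Ξ ^ (rdim F * ν / 2) * detF S ^ (rdim F * m / 2) with hD
  have hDp : 0 < D := by positivity
  refine ⟨ENNReal.ofReal (mvGamma F m a / D), ?_, ?_⟩
  · rw [← withDensity_smul _ (measurable_tKernel Ξ S a μ), matricvariateT]
    congr 1
    funext T
    rw [Pi.smul_apply, smul_eq_mul, tKernel, ← ENNReal.ofReal_mul (by positivity)]
  · rw [lintegral_matVolume_sub μ (tKernel Ξ S a)]
    have h := lgamma_mul_lintegral hΞ.inverse hS.inverse a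
    rw [← ofReal_mvGamma haβ, hb, ← ofReal_mvGamma hνβ, detF_inverse _ hΞ.isUnit,
      detF_inverse _ hS.isUnit, Real.inv_rpow hΞp.le, Real.inv_rpow hSp.le, Real.rpow_neg hΞp.le,
      Real.rpow_neg hSp.le, inv_inv, inv_inv, ← ENNReal.ofReal_mul (by positivity)] at h
    have hDe : Real.pi ^ (m * n * rdim F / 2) * detF Ξ ^ (rdim F * ν / 2) *
        detF S ^ (rdim F * m / 2) * mvGamma F m (rdim F * ν / 2) = D := by rw [hD]; ring
    rw [hDe] at h
    rw [div_eq_inv_mul, ENNReal.ofReal_mul (by positivity), mul_assoc]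
    simp only [tKernel]
    rw [h, ← ENNReal.ofReal_mul (by positivity), inv_mul_cancel₀ hDp.ne', ENNReal.ofReal_one]

end Laws

/-! ### Mixing over the random square root -/

section Representation

variable {F : Type*} [NormedDivisionRing F] [StarRing F] [InnerProductSpace ℝ F]
  [RealNormedDivisionAlgebra F] [FiniteDimensional ℝ F] [MeasurableSpace F] [BorelSpace F]
  {m n : ℕ}

theorem measurable_mul_inverse_add (μ : Matrix (Fin m) (Fin n) F) :
    Measurable fun z : Matrix (Fin n) (Fin n) F × Matrix (Fin m) (Fin n) F =>
      z.2 * Ring.inverse z.1 + μ := by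
  have hc : Continuous fun z : Matrix (Fin n) (Fin n) F × Matrix (Fin m) (Fin n) F =>
    z.2 * z.1 + μ := by fun_prop
  exact hc.measurable.comp ((measurable_ringInverse.comp measurable_fst).prodMk measurable_snd)

/-- Mixing the density of `X L⁻¹ + μ` over a Wishart law of `L Lᴴ`. -/
theorem lintegral_wishart_scaleKernel {S : Matrix (Fin n) (Fin n) F} (hS : IsPosDef S) (N : ℝ)
    (Ξ : Matrix (Fin m) (Fin m) F) (μ : Matrix (Fin m) (Fin n) F)
    {f : Matrix (Fin m) (Fin n) F → ENNReal} (hf : Measurable f) :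
    ∫⁻ V, ∫⁻ T, scaleKernel Ξ (T - μ) V * f T ∂matVolume F m n ∂wishart N (Ring.inverse S)
      = ∫⁻ T, (∫⁻ V in {V : Matrix (Fin n) (Fin n) F | IsPosDef V},
          wishartKernel N S V * scaleKernel Ξ (T - μ) V ∂hermVolume F n) * f T
        ∂matVolume F m n := by
  have hw := measurable_wishartKernel N S
  have hk := measurable_scaleKernel Ξ μ
  have hkf : Measurable fun z : Matrix (Fin n) (Fin n) F × Matrix (Fin m) (Fin n) F =>
      scaleKernel Ξ (z.2 - μ) z.1 * f z.2 := hk.mul (hf.comp measurable_snd)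
  have hinner : Measurable fun V : Matrix (Fin n) (Fin n) F =>
      ∫⁻ T, scaleKernel Ξ (T - μ) V * f T ∂matVolume F m n := hkf.lintegral_prod_right'
  have hkV : ∀ V : Matrix (Fin n) (Fin n) F,
      Measurable fun T => scaleKernel Ξ (T - μ) V * f T := by
    intro V
    have h := hkf.comp ((measurable_const (a := V)).prodMk measurable_id)
    exact h
  have hkT : ∀ T : Matrix (Fin m) (Fin n) F,
      Measurable fun V => scaleKernel Ξ (T - μ) V := by
    intro T
    have h := hk.comp (measurable_id.prodMk (measurable_const (a := T)))
    exact h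
  rw [wishart_eq hS, lintegral_withDensity_eq_lintegral_mul _ hw hinner]
  simp only [Pi.mul_apply]
  simp_rw [← fun V : Matrix (Fin n) (Fin n) F => lintegral_const_mul (μ := matVolume F m n)
    (wishartKernel N S V) (hkV V)]
  rw [lintegral_lintegral_swap ((hw.comp measurable_fst).mul hkf).aemeasurable]
  refine lintegral_congr fun T => ?_
  have hwk : Measurable fun V => wishartKernel N S V * scaleKernel Ξ (T - μ) V := hw.mul (hkT T)
  rw [← lintegral_mul_const _ hwk]
  exact lintegral_congr fun V => (mul_assoc _ _ _).symm

/-- By independence the joint law is a product, so one integrates over X with L frozen; almost sure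
invertibility of L suffices. -/
theorem lintegral_map_mul_inverse_add {Ω : Type*} [MeasurableSpace Ω] {P : Measure Ω}
    [IsProbabilityMeasure P] {Ξ : Matrix (Fin m) (Fin m) F} (hΞ : IsPosDef Ξ)
    {X : Ω → Matrix (Fin m) (Fin n) F} (hX : HasLaw X (matrixNormal 0 (Ring.inverse Ξ) 1) P)
    {L : Ω → Matrix (Fin n) (Fin n) F} (hL : AEMeasurable L P) (hLu : ∀ᵐ ω ∂P, IsUnit (L ω))
    (hind : IndepFun L X P) (μ : Matrix (Fin m) (Fin n) F)
    {f : Matrix (Fin m) (Fin n) F → ENNReal} (hf : Measurable f) :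
    ∫⁻ T, f T ∂(P.map fun ω => X ω * Ring.inverse (L ω) + μ)
      = ∫⁻ ω, ∫⁻ T, scaleKernel Ξ (T - μ) (L ω * (L ω)ᴴ) * f T ∂matVolume F m n ∂P := by
  have hφ := measurable_mul_inverse_add μ
  have hjoint : P.map (fun ω => X ω * Ring.inverse (L ω) + μ)
      = ((P.map L).prod (P.map X)).map fun z => z.2 * Ring.inverse z.1 + μ := by
    rw [← (indepFun_iff_map_prod_eq_prod_map_map hL hX.aemeasurable).1 hind,
      AEMeasurable.map_map_of_aemeasurable hφ.aemeasurable (hL.prodMk hX.aemeasurable)]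
    rfl
  have hXp : IsProbabilityMeasure (P.map X) := Measure.isProbabilityMeasure_map hX.aemeasurable
  have hfφ : Measurable fun z : Matrix (Fin n) (Fin n) F × Matrix (Fin m) (Fin n) F =>
      f (z.2 * Ring.inverse z.1 + μ) := hf.comp hφ
  rw [hjoint, lintegral_map hf hφ, lintegral_prod _ hfφ.aemeasurable,
    lintegral_map' hfφ.lintegral_prod_right'.aemeasurable hL]
  refine lintegral_congr_ae ?_
  filter_upwards [hLu] with ω h
  rw [hX.map_eq, lintegral_matrixNormal hΞ h μ hf]

end Representation

end NDA

end

/-! ### Assembly: identifying the two laws -/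

theorem mainTheorem2
    {F : Type*} [NormedDivisionRing F] [StarRing F] [InnerProductSpace ℝ F]
    [NDA.RealNormedDivisionAlgebra F] [FiniteDimensional ℝ F] [MeasurableSpace F] [BorelSpace F]
    {Ω : Type*} [MeasurableSpace Ω] (P : Measure Ω) [IsProbabilityMeasure P]
    {m n : ℕ} (ν : ℝ) (hν : (m : ℝ) - 1 < ν)
    (μ : Matrix (Fin m) (Fin n) F)
    (Ξ : Matrix (Fin m) (Fin m) F) (hΞ : NDA.IsPosDef Ξ)
    (S : Matrix (Fin n) (Fin n) F) (hS : NDA.IsPosDef S)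
    (X : Ω → Matrix (Fin m) (Fin n) F)
    (hX : HasLaw X (NDA.matrixNormal 0 (Ring.inverse Ξ) 1) P)
    (U : Ω → Matrix (Fin n) (Fin n) F)
    (hU : HasLaw U (NDA.wishart (ν + n - m) (Ring.inverse S)) P)
    (L₁ : Ω → Matrix (Fin n) (Fin n) F) (hL₁ : AEMeasurable L₁ P)
    (hL₁U : ∀ᵐ ω ∂P, L₁ ω * (L₁ ω)ᴴ = U ω)
    (hind : IndepFun L₁ X P) :
    HasLaw (fun ω => X ω * Ring.inverse (L₁ ω) + μ) (NDA.matricvariateT ν μ Ξ S) P := by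
  have hT : AEMeasurable (fun ω => X ω * Ring.inverse (L₁ ω) + μ) P := by
    have h := (NDA.measurable_mul_inverse_add μ).comp_aemeasurable (hL₁.prodMk hX.aemeasurable)
    exact h
  have hpd : ∀ᵐ ω ∂P, NDA.IsPosDef (U ω) := by
    refine ae_of_ae_map hU.aemeasurable ?_
    rw [hU.map_eq, NDA.wishart_eq hS]
    exact (withDensity_absolutelyContinuous _ _).ae_le
      (ae_restrict_mem NDA.measurableSet_isPosDef)
  have hLu : ∀ᵐ ω ∂P, IsUnit (L₁ ω) := by
    filter_upwards [hL₁U, hpd] with ω h1 h2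
    exact NDA.isUnit_of_isPosDef_mul_conjTranspose (h1 ▸ h2)
  obtain ⟨C, hC⟩ := NDA.exists_lintegral_wishartKernel_mul_scaleKernel hΞ hS ν
  set a : ℝ := NDA.rdim F * (n + ν) / 2
  have hlint : ∀ f : Matrix (Fin m) (Fin n) F → ENNReal, Measurable f →
      ∫⁻ T, f T ∂(P.map fun ω => X ω * Ring.inverse (L₁ ω) + μ)
        = ∫⁻ T, C * NDA.tKernel Ξ S a (T - μ) * f T ∂NDA.matVolume F m n := by
    intro f hf
    have hinner : Measurable fun V : Matrix (Fin n) (Fin n) F =>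
        ∫⁻ T, NDA.scaleKernel Ξ (T - μ) V * f T ∂NDA.matVolume F m n :=
      ((NDA.measurable_scaleKernel Ξ μ).mul (hf.comp measurable_snd)).lintegral_prod_right'
    -- Here the chosen square root disappears: the integrand involves only L₁L₁ᴴ = U.
    have hω : ∀ᵐ ω ∂P,
        ∫⁻ T, NDA.scaleKernel Ξ (T - μ) (L₁ ω * (L₁ ω)ᴴ) * f T ∂NDA.matVolume F m n
          = ∫⁻ T, NDA.scaleKernel Ξ (T - μ) (U ω) * f T ∂NDA.matVolume F m n := by
      filter_upwards [hL₁U] with ω h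
      rw [h]
    rw [NDA.lintegral_map_mul_inverse_add hΞ hX hL₁ hLu hind μ hf, lintegral_congr_ae hω,
      ← lintegral_map' hinner.aemeasurable hU.aemeasurable, hU.map_eq,
      NDA.lintegral_wishart_scaleKernel hS _ Ξ μ hf]
    simp_rw [hC]
  have hK := NDA.measurable_tKernel Ξ S a μ
  have hmap : P.map (fun ω => X ω * Ring.inverse (L₁ ω) + μ)
      = C • (NDA.matVolume F m n).withDensity fun T => NDA.tKernel Ξ S a (T - μ) := by
    rw [← withDensity_smul _ hK]
    ext E hE
    have h := hlint (E.indicator 1) (measurable_one.indicator hE)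
    rw [lintegral_indicator_one hE] at h
    rw [h, withDensity_apply _ hE, ← lintegral_indicator hE]
    refine lintegral_congr fun T => ?_
    by_cases hTE : T ∈ E <;> simp [hTE]
  obtain ⟨C', hC', hmass⟩ := NDA.matricvariateT_eq ν μ hν hΞ hS
  have hprob : C * ∫⁻ T, NDA.tKernel Ξ S a (T - μ) ∂NDA.matVolume F m n = 1 := by
    have := Measure.isProbabilityMeasure_map (μ := P) hT
    have h1 := measure_univ (μ := P.map fun ω => X ω * Ring.inverse (L₁ ω) + μ)
    rwa [hmap, Measure.smul_apply, withDensity_apply _ MeasurableSet.univ, Measure.restrict_univ,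
      smul_eq_mul] at h1
  -- Both constants normalize the same kernel integral; inserting each normalization in turn avoids
  -- division in the extended reals.
  have hCC : C = C' := by
    calc C = C * (C' * ∫⁻ T, NDA.tKernel Ξ S a (T - μ) ∂NDA.matVolume F m n) := by
          rw [hmass, mul_one]
      _ = C' * (C * ∫⁻ T, NDA.tKernel Ξ S a (T - μ) ∂NDA.matVolume F m n) := by ring
      _ = C' := by rw [hprob, mul_one]
  exact ⟨hT, by rw [hmap, hC', hCC]⟩
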